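/- Graphs are finite and loopless; multiple edges are allowed. Write $\omega(G)$ for the number of components of $G$ and $d_G(v)$ for the degree of $v$. Let $m\ge 1$ be an integer. A graph is $m$-tree-connected if it has $m$ pairwise edge-disjoint spanning trees; the $m$-tree-connected components of a graph are its maximal induced $m$-tree-connected subgraphs. For a subgraph $C$ of a graph $F$, let $d_F(C)$ be the number of edges of $F$ with exactly one end in $V(C)$. Let $G$ be a graph with a spanning subgraph $F$, and let $c\ge 2m+1$ be a real number. Suppose that every $m$-tree-connected component $C$ of $F$ satisfies $$|V(C)|\ \ge\ c-\frac{c-1}{2m}\,d_F(C),$$ and that for every $S\subseteq V(G)$, $$\omega(G\setminus S)\ \le\ \frac{c-2m}{2m(c-1)}\,|S|+1 .$$ Then for every vertex $u$ of $G$ there is an $m$-tree-connected spanning subgraph $H$ of $G$ containing $F$ such that $d_H(v)\le d_F(v)+1$ for every vertex $v$ and $d_H(u)=d_F(u)$. -/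

import Mathlib

open scoped Graph

namespace Graph

variable {α β : Type*}

/-- The degree of a vertex: the number of edges incident to it. It is only used for loopless
graphs, where every incident edge counts once. -/
noncomputable def degree (G : Graph α β) (v : α) : ℕ := (G.incidenceSet v).ncard

/-- The number of edges with exactly one end in the vertex set `X`. -/
noncomputable def boundaryDegree (G : Graph α β) (X : Set α) : ℕ :=
  {e | ∃ x ∈ X, ∃ y ∉ X, G.IsLink e x y}.ncard

/-- The number of connected components (it is `0` for the graph without vertices). -/
noncomputable def numComponents (G : Graph α β) : ℕ := Nat.card G.toSimpleGraph.ConnectedComponent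

/-- A (multi)graph is a tree if it has no loops or parallel edges and, as a simple graph, it is
connected (in particular, nonempty) and acyclic. -/
def IsTree (T : Graph α β) : Prop := T.Simple ∧ T.toSimpleGraph.IsTree

/-- `G` is `m`-tree-connected if it has `m` pairwise edge-disjoint spanning trees. -/
def IsTreeConnected (G : Graph α β) (m : ℕ) : Prop :=
  ∃ T : Fin m → Graph α β,
    (∀ i, T i ≤s G ∧ (T i).IsTree) ∧ Pairwise fun i j => Disjoint E(T i) E(T j)

/-- `X` is the vertex set of an `m`-tree-connected component of `G`, i.e. of a maximal induced
`m`-tree-connected subgraph `G[X]`. -/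
def IsTreeComponent (G : Graph α β) (m : ℕ) (X : Set α) : Prop :=
  Maximal (fun Y : Set α => Y ⊆ V(G) ∧ (G.induce Y).IsTreeConnected m) X

end Graph

/-!
A set `B` of edges is called sparse if every nonempty vertex set `X` spans at most `m * #X - m` of
them, and `X` is tight if it attains this bound. By Nash-Williams' theorem the tight sets of a
maximal sparse set `B` of edges of `F` are `m`-tree-connected, and the maximal ones among them are
the `m`-tree-connected components of `F`. So it suffices to find a matching `M` outside `F` that
avoids `u` such that `B ∪ M` is sparse and the whole vertex set is tight.

Take `M` as large as possible subject to sparsity. Exchanging edges of `M` inside tight sets, as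
with alternating paths, yields a set `W` of vertices that contains all vertices other than `u` that
`M` misses, and for which both ends of every edge of `G[W]` outside `F` lie in a common tight set of
`B` and the edges of `M` inside `W`. Consider the partition into the maximal tight sets for this
union. A set `K ⊆ W` that spans no edge between two blocks meets at most as many blocks as
`G[K]` has components, and their number is bounded by the toughness condition. If the blocks that
`K` misses are charged against their sizes and boundaries, the two conditions show that so many
edges run between the blocks that `B ∪ M` must have `m * (#V - 1)` edges.
-/

namespace EdgeSparse

open Finset

/-! ### Sparse and tight sets -/

section SparseSets

variable {α β : Type*}

/-- `v` is an end of `e`. A multigraph is given by two functions `p q : β → α` that name the two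
ends of an edge, and a subgraph by the finite set of its edges. -/
def Inc (p q : β → α) (e : β) (v : α) : Prop := p e = v ∨ q e = v

lemma Inc.mem {p q : β → α} {X : Finset α} {e : β} {v : α} (h : Inc p q e v)
    (he : p e ∈ X ∧ q e ∈ X) : v ∈ X := by
  rcases h with rfl | rfl
  exacts [he.1, he.2]

variable [DecidableEq α]

/-- The edges of `B` with both ends in `X`. -/
def inside (p q : β → α) (B : Finset β) (X : Finset α) : Finset β :=
  B.filter fun e => p e ∈ X ∧ q e ∈ X

/-- `B` is `(k, k)`-sparse: a nonempty vertex set `X` spans at most `k * #X - k` edges of `B`. -/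
def Sparse (p q : β → α) (k : ℕ) (B : Finset β) : Prop :=
  ∀ X : Finset α, X.Nonempty → #(inside p q B X) + k ≤ k * #X

/-- `X` attains equality in the sparsity condition for `B`. -/
def Tight (p q : β → α) (k : ℕ) (B : Finset β) (X : Finset α) : Prop :=
  X.Nonempty ∧ #(inside p q B X) + k = k * #X

/-- Both ends of `e` lie in a common tight set of `B`. For a sparse set `B` that does not contain
`e` this says that `insert e B` is not sparse. -/
def Spans (p q : β → α) (k : ℕ) (B : Finset β) (e : β) : Prop :=
  ∃ T, Tight p q k B T ∧ p e ∈ T ∧ q e ∈ T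

/-- `T` is the smallest tight set of `B` that contains both ends of `e`. -/
def IsSpan (p q : β → α) (k : ℕ) (B : Finset β) (e : β) (T : Finset α) : Prop :=
  Tight p q k B T ∧ p e ∈ T ∧ q e ∈ T ∧ ∀ Z, Tight p q k B Z → p e ∈ Z → q e ∈ Z → T ⊆ Z

/-- The set of all ends of the edges of `B`. -/
def ends (p q : β → α) (B : Finset β) : Finset α := B.image p ∪ B.image q

variable {p q : β → α} {k : ℕ} {B B' : Finset β} {X Y T : Finset α} {e f : β} {v : α}

lemma mem_inside : e ∈ inside p q B X ↔ e ∈ B ∧ p e ∈ X ∧ q e ∈ X := by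
  simp [inside]

lemma mem_ends : v ∈ ends p q B ↔ ∃ e ∈ B, Inc p q e v := by
  simp only [ends, mem_union, mem_image, Inc]
  grind

lemma inside_subset : inside p q B X ⊆ B := filter_subset _ _

lemma inside_mono (hB : B ⊆ B') (hX : X ⊆ Y) : inside p q B X ⊆ inside p q B' Y := fun e he => by
  rw [mem_inside] at he ⊢
  exact ⟨hB he.1, hX he.2.1, hX he.2.2⟩

lemma sparse_empty : Sparse p q k (∅ : Finset β) := fun X hX => by
  simpa [inside] using Nat.le_mul_of_pos_right k hX.card_pos

lemma Sparse.mono (hB' : Sparse p q k B') (h : B ⊆ B') : Sparse p q k B := fun X hX =>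
  (Nat.add_le_add_right (card_le_card (inside_mono h Subset.rfl)) k).trans (hB' X hX)

lemma Sparse.inside_singleton (hB : Sparse p q k B) (v : α) : inside p q B {v} = ∅ := by
  have := hB {v} (singleton_nonempty v)
  rw [← card_eq_zero]
  rw [card_singleton] at this
  lia

lemma Sparse.tight_singleton (hB : Sparse p q k B) (v : α) : Tight p q k B {v} :=
  ⟨singleton_nonempty v, by simp [hB.inside_singleton v]⟩

lemma Sparse.ne (hB : Sparse p q k B) (he : e ∈ B) : p e ≠ q e := fun hpq => by
  have hmem : e ∈ inside p q B {q e} := mem_inside.2 ⟨he, by simp [hpq], by simp⟩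
  simp [hB.inside_singleton] at hmem

lemma inside_eq_self (hB : ∀ e ∈ B, p e ∈ X ∧ q e ∈ X) : inside p q B X = B :=
  filter_true_of_mem hB

lemma Tight.inside_eq (hX : Tight p q k B X) (h : B ⊆ B') (hB' : Sparse p q k B') :
    inside p q B' X = inside p q B X := by
  have := hB' X hX.1
  have := hX.2
  exact (eq_of_subset_of_card_le (inside_mono h Subset.rfl) (by lia)).symm

lemma Tight.mono (hX : Tight p q k B X) (h : B ⊆ B') (hB' : Sparse p q k B') :
    Tight p q k B' X :=
  ⟨hX.1, by rw [hX.inside_eq h hB', hX.2]⟩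

lemma Spans.mono (he : Spans p q k B e) (h : B ⊆ B') (hB' : Sparse p q k B') :
    Spans p q k B' e :=
  let ⟨T, hT, heT⟩ := he
  ⟨T, hT.mono h hB', heT⟩

lemma Tight.of_card_inside_eq (hX : Tight p q k B X)
    (h : #(inside p q B' X) = #(inside p q B X)) : Tight p q k B' X :=
  ⟨hX.1, h ▸ hX.2⟩

lemma mul_card_union_add_mul_card_inter (k : ℕ) (X Y : Finset α) :
    k * #(X ∪ Y) + k * #(X ∩ Y) = k * #X + k * #Y := by
  rw [← mul_add, ← mul_add, card_union_add_card_inter]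

variable [DecidableEq β]

lemma inside_union_subset : inside p q B X ∪ inside p q B Y ⊆ inside p q B (X ∪ Y) :=
  union_subset (inside_mono Subset.rfl subset_union_left)
    (inside_mono Subset.rfl subset_union_right)

lemma inside_inter : inside p q B X ∩ inside p q B Y = inside p q B (X ∩ Y) := by
  ext e
  simp only [mem_inter, mem_inside]
  tauto

lemma inside_insert (he : p e ∈ X ∧ q e ∈ X) :
    inside p q (insert e B) X = insert e (inside p q B X) := by
  rw [inside, filter_insert, if_pos he, inside]

lemma inside_insert_of_not (he : ¬ (p e ∈ X ∧ q e ∈ X)) :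
    inside p q (insert e B) X = inside p q B X := by
  rw [inside, filter_insert, if_neg he, inside]

lemma inside_union_edges : inside p q (B ∪ B') X = inside p q B X ∪ inside p q B' X :=
  filter_union _ _ _

lemma inside_erase : inside p q (B.erase f) X = (inside p q B X).erase f :=
  filter_erase _ _ _

omit [DecidableEq β] in
lemma card_inside_add_card_inside_le :
    #(inside p q B X) + #(inside p q B Y) ≤
      #(inside p q B (X ∪ Y)) + #(inside p q B (X ∩ Y)) := by
  classical
  rw [← card_union_add_card_inter, inside_inter]
  gcongr
  exact inside_union_subset

lemma card_inside_insert_erase (hf : f ∈ inside p q B X) (he : e ∉ B)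
    (heX : p e ∈ X ∧ q e ∈ X) : #(inside p q (insert e (B.erase f)) X) = #(inside p q B X) := by
  have heX' : e ∉ (inside p q B X).erase f := fun h => he (inside_subset (mem_of_mem_erase h))
  rw [inside_insert heX, inside_erase, card_insert_of_notMem heX', card_erase_add_one hf]

omit [DecidableEq β] in
lemma Tight.union_inter (hX : Tight p q k B X) (hY : Tight p q k B Y) (hB : Sparse p q k B)
    (hXY : (X ∩ Y).Nonempty) : Tight p q k B (X ∪ Y) ∧ Tight p q k B (X ∩ Y) := by
  have hunion : (X ∪ Y).Nonempty := hX.1.mono subset_union_left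
  have := hB _ hunion
  have := hB _ hXY
  have := card_inside_add_card_inside_le (p := p) (q := q) (B := B) (X := X) (Y := Y)
  have := mul_card_union_add_mul_card_inter k X Y
  have := hX.2
  have := hY.2
  exact ⟨⟨hunion, by lia⟩, ⟨hXY, by lia⟩⟩

omit [DecidableEq β] in
lemma Tight.disjoint_of_not_spans (hX : Tight p q k B X) (hY : Tight p q k B Y)
    (hB : Sparse p q k B) (hp : p e ∈ X) (hq : q e ∈ Y) (hno : ¬ Spans p q k B e) :
    Disjoint X Y := by
  rw [disjoint_iff_inter_eq_empty, ← not_nonempty_iff_eq_empty]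
  exact fun hne => hno ⟨X ∪ Y, (hX.union_inter hY hB hne).1, mem_union_left _ hp,
    mem_union_right _ hq⟩

lemma Tight.inside_union (hX : Tight p q k B X) (hY : Tight p q k B Y) (hB : Sparse p q k B)
    (hXY : (X ∩ Y).Nonempty) :
    inside p q B (X ∪ Y) = inside p q B X ∪ inside p q B Y := by
  obtain ⟨hunion, hinter⟩ := hX.union_inter hY hB hXY
  refine (eq_of_subset_of_card_le inside_union_subset ?_).symm
  have := card_union_add_card_inter (inside p q B X) (inside p q B Y)
  rw [inside_inter] at this
  have := mul_card_union_add_mul_card_inter k X Y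
  have := hX.2
  have := hY.2
  have := hunion.2
  have := hinter.2
  lia

omit [DecidableEq β] in
lemma Tight.exists_crossing (hT : Tight p q k B T) (hk : 1 ≤ k) (hB : Sparse p q k B)
    (hTX : (T ∩ X).Nonempty) (hTX' : ¬ T ⊆ X) :
    ∃ f ∈ inside p q B T, (p f ∈ X ∧ q f ∉ X) ∨ (p f ∉ X ∧ q f ∈ X) := by
  classical
  by_contra! hcon
  have hcover : inside p q B T ⊆ inside p q B (T ∩ X) ∪ inside p q B (T \ X) := by
    intro f hf
    have := hcon f hf
    simp only [mem_union, mem_inside, mem_inter, mem_sdiff] at hf ⊢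
    tauto
  have hle := (card_le_card hcover).trans (card_union_le _ _)
  have := hB _ hTX
  have := hB (T \ X) (by rwa [sdiff_nonempty])
  have := hT.2
  have : k * #(T ∩ X) + k * #(T \ X) = k * #T := by
    rw [← mul_add, add_comm, card_sdiff_add_card_inter]
  lia

lemma spans_of_not_sparse_insert (hB : Sparse p q k B) (he : ¬ Sparse p q k (insert e B)) :
    Spans p q k B e := by
  simp only [Sparse, not_forall] at he
  obtain ⟨X, hX, hlt⟩ := he
  have hle := hB X hX
  by_cases heX : p e ∈ X ∧ q e ∈ X
  · rw [inside_insert heX] at hlt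
    have := card_insert_le e (inside p q B X)
    exact ⟨X, ⟨hX, by lia⟩, heX⟩
  · rw [inside_insert_of_not heX] at hlt
    exact absurd hle hlt

omit [DecidableEq β] in
lemma Spans.exists_isSpan (h : Spans p q k B e) (hB : Sparse p q k B) :
    ∃ T, IsSpan p q k B e T := by
  obtain ⟨T, hT, hmin⟩ := exists_minimalFor_of_wellFoundedLT
    (fun T => Tight p q k B T ∧ p e ∈ T ∧ q e ∈ T) (fun T : Finset α => #T) h
  refine ⟨T, hT.1, hT.2.1, hT.2.2, fun Z hZ hpZ hqZ => ?_⟩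
  have hpTZ : p e ∈ T ∩ Z := mem_inter.2 ⟨hT.2.1, hpZ⟩
  have hcard := hmin ⟨(hT.1.union_inter hZ hB ⟨_, hpTZ⟩).2, hpTZ, mem_inter.2 ⟨hT.2.2, hqZ⟩⟩
    (card_le_card inter_subset_left)
  exact inter_eq_left.1 (eq_of_subset_of_card_le inter_subset_left hcard)

lemma IsSpan.sparse_insert_erase (hT : IsSpan p q k B e T) (hB : Sparse p q k B) (he : e ∉ B)
    (hf : f ∈ inside p q B T) : Sparse p q k (insert e (B.erase f)) := by
  intro X hX
  have hle := hB X hX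
  have herase : #(inside p q (B.erase f) X) ≤ #(inside p q B X) :=
    card_le_card (inside_mono (erase_subset _ _) Subset.rfl)
  by_cases heX : p e ∈ X ∧ q e ∈ X
  · by_cases htight : Tight p q k B X
    · have hTX := hT.2.2.2 X htight heX.1 heX.2
      rwa [card_inside_insert_erase (inside_mono Subset.rfl hTX hf) he heX]
    · have hlt : #(inside p q B X) + k ≠ k * #X := fun h => htight ⟨hX, h⟩
      rw [inside_insert heX]
      have := card_insert_le e (inside p q (B.erase f) X)
      lia
  · rw [inside_insert_of_not heX]
    lia

lemma Sparse.sdiff_inside_union (hB : Sparse p q k B) (hX : Tight p q k B X)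
    (hB' : Sparse p q k B') :
    Sparse p q k (B \ inside p q B X ∪ inside p q B' X) := by
  intro Z hZ
  have hsub : inside p q (B \ inside p q B X ∪ inside p q B' X) Z ⊆
      (inside p q B Z \ inside p q B (Z ∩ X)) ∪ inside p q B' (Z ∩ X) := by
    intro e he
    simp only [mem_union, mem_inside, mem_inter, mem_sdiff] at he ⊢
    tauto
  have hle := (card_le_card hsub).trans (card_union_le _ _)
  have hsdiff : #(inside p q B Z \ inside p q B (Z ∩ X)) + #(inside p q B (Z ∩ X)) =
      #(inside p q B Z) :=
    card_sdiff_add_card_eq_card (inside_mono Subset.rfl inter_subset_left)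
  rcases (Z ∩ X).eq_empty_or_nonempty with hZX | hZX
  · have : #(inside p q B' (Z ∩ X)) = 0 := by simp [hZX, inside]
    have := hB Z hZ
    lia
  · have := hB' _ hZX
    have := card_inside_add_card_inside_le (p := p) (q := q) (B := B) (X := Z) (Y := X)
    have := hB (Z ∪ X) (hZ.mono subset_union_left)
    have := hX.2
    have := mul_card_union_add_mul_card_inter k Z X
    lia

end SparseSets

/-! ### Decompositions into sparse sets -/

section Decomposition

open Function

variable {α β ι : Type*} [DecidableEq α] [DecidableEq β]

/-- The sets `T i` form a partition of `B` in which `T i` is `(k i, k i)`-sparse. -/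
structure IsSparseDecomposition (p q : β → α) (k : ι → ℕ) (B : Finset β)
    (T : ι → Finset β) : Prop where
  sparse : ∀ i, Sparse p q (k i) (T i)
  disjoint : Pairwise fun i j => Disjoint (T i) (T j)
  mem_iff : ∀ e, e ∈ B ↔ ∃ i, e ∈ T i

/-- `Reach p q k T₀ e₀ T e`: the family `T` with the left-over edge `e` arises from `T₀` and `e₀`
by repeatedly putting the left-over edge into one of the sets, in exchange for an edge of its span
there. -/
inductive Reach [DecidableEq ι] (p q : β → α) (k : ι → ℕ) (T₀ : ι → Finset β) (e₀ : β) :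
    (ι → Finset β) → β → Prop
  | refl : Reach p q k T₀ e₀ T₀ e₀
  | step {T e i X f} : Reach p q k T₀ e₀ T e → IsSpan p q (k i) (T i) e X →
      f ∈ inside p q (T i) X → Reach p q k T₀ e₀ (update T i (insert e ((T i).erase f))) f

/-- `v` is an end of a left-over edge that can be reached. -/
def IsReachEnd [DecidableEq ι] (p q : β → α) (k : ι → ℕ) (T₀ : ι → Finset β) (e₀ : β)
    (v : α) : Prop :=
  ∃ T e, Reach p q k T₀ e₀ T e ∧ Inc p q e v

variable {p q : β → α} {k : ι → ℕ} {B D : Finset β} {T T₀ : ι → Finset β} {e e₀ f : β}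
  {U W X : Finset α} {i j : ι}

namespace IsSparseDecomposition

omit [DecidableEq β] in
lemma subset (h : IsSparseDecomposition p q k B T) (i : ι) : T i ⊆ B :=
  fun e he => (h.mem_iff e).2 ⟨i, he⟩

omit [DecidableEq β] in
lemma card_inside [Fintype ι] (h : IsSparseDecomposition p q k B T) (X : Finset α) :
    #(inside p q B X) = ∑ i, #(inside p q (T i) X) := by
  classical
  rw [← card_biUnion fun i _ j _ hij => (h.disjoint hij).mono inside_subset inside_subset]
  congr 1
  ext e
  simp only [mem_inside, mem_biUnion, mem_univ, true_and, h.mem_iff e, exists_and_right]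

omit [DecidableEq β] in
lemma inside_eq_of_tight [Fintype ι] (h : IsSparseDecomposition p q k D T)
    (hB : Sparse p q (∑ i, k i) B) (hDB : D ⊆ B) (hX : ∀ i, Tight p q (k i) (T i) X)
    (hne : X.Nonempty) : inside p q B X = inside p q D X := by
  refine (eq_of_subset_of_card_le (inside_mono hDB Subset.rfl) ?_).symm
  have hsum : ∑ i, (#(inside p q (T i) X) + k i) = (∑ i, k i) * #X := by
    rw [sum_mul]
    exact sum_congr rfl fun i _ => (hX i).2
  rw [sum_add_distrib, ← h.card_inside] at hsum
  have := hB X hne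
  lia

variable [DecidableEq ι]

lemma update (h : IsSparseDecomposition p q k B T) (hD : Sparse p q (k i) D)
    (hDB : ∀ e ∈ D, e ∈ T i ∨ e ∉ B) :
    IsSparseDecomposition p q k (B \ T i ∪ D) (update T i D) := by
  have hdisj : ∀ j, j ≠ i → Disjoint D (T j) := fun j hj => disjoint_left.2 fun e he hej =>
    (hDB e he).elim (fun hei => disjoint_left.1 (h.disjoint hj) hej hei)
      fun heB => heB (h.subset j hej)
  refine ⟨fun j => ?_, fun j j' hjj' => ?_, fun e => ?_⟩
  · obtain rfl | hj := eq_or_ne j i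
    · simpa using hD
    · simpa [hj] using h.sparse j
  · obtain rfl | hj := eq_or_ne j i
    · simpa [hjj'.symm] using hdisj j' hjj'.symm
    · obtain rfl | hj' := eq_or_ne j' i
      · simpa [hj] using (hdisj j hj).symm
      · simpa [hj, hj'] using h.disjoint hjj'
  · simp only [mem_union, mem_sdiff, h.mem_iff]
    constructor
    · rintro (⟨⟨j, hj⟩, hei⟩ | he)
      · exact ⟨j, by rwa [update_of_ne (by rintro rfl; exact hei hj)]⟩
      · exact ⟨i, by simpa using he⟩
    · rintro ⟨j, hj⟩
      obtain rfl | hji := eq_or_ne j i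
      · simp only [update_self] at hj
        exact .inr hj
      · rw [update_of_ne hji] at hj
        exact .inl ⟨⟨j, hj⟩, disjoint_left.1 (h.disjoint hji) hj⟩

omit [DecidableEq ι] in
lemma spans (h : IsSparseDecomposition p q k (B.erase e) T) (he : e ∈ B)
    (hno : ¬ ∃ T, IsSparseDecomposition p q k B T) (i : ι) : Spans p q (k i) (T i) e := by
  classical
  refine spans_of_not_sparse_insert (h.sparse i) fun hs =>
    hno ⟨Function.update T i (insert e (T i)), ?_⟩
  have hupdate := h.update hs fun x hx => (mem_insert.1 hx).elim (fun hxe => .inr (by simp [hxe]))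
    .inl
  convert hupdate using 1
  ext x
  have hmem : x ∈ T i → x ∈ B.erase e := fun hx => h.subset i hx
  simp only [mem_erase] at hmem
  simp only [mem_union, mem_sdiff, mem_erase, mem_insert]
  grind

lemma exchange (h : IsSparseDecomposition p q k (B.erase e) T) (he : e ∈ B)
    (hX : IsSpan p q (k i) (T i) e X) (hf : f ∈ inside p q (T i) X) :
    IsSparseDecomposition p q k (B.erase f) (Function.update T i (insert e ((T i).erase f))) := by
  have hei : e ∉ T i := fun hmem => notMem_erase e B (h.subset i hmem)
  have hfi := inside_subset hf
  have hupdate := h.update (hX.sparse_insert_erase (h.sparse i) hei hf) fun x hx => by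
    simp only [mem_insert, mem_erase] at hx ⊢
    tauto
  convert hupdate using 1
  ext x
  have hmem : x ∈ T i → x ∈ B.erase e := fun hx => h.subset i hx
  simp only [mem_erase] at hmem
  simp only [mem_union, mem_sdiff, mem_erase, mem_insert]
  grind

end IsSparseDecomposition

variable [DecidableEq ι]

lemma Reach.isSparseDecomposition (h : Reach p q k T₀ e₀ T e) (he₀ : e₀ ∈ B)
    (h₀ : IsSparseDecomposition p q k (B.erase e₀) T₀) :
    e ∈ B ∧ IsSparseDecomposition p q k (B.erase e) T := by
  induction h with
  | refl => exact ⟨he₀, h₀⟩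
  | step _ hX hf ih =>
    exact ⟨mem_of_mem_erase (ih.2.subset _ (inside_subset hf)), ih.2.exchange ih.1 hX hf⟩

lemma Reach.isReachEnd_of_isSpan (h : Reach p q k T₀ e₀ T e) (hk : 1 ≤ k i)
    (hT : Sparse p q (k i) (T i)) (hne : p e ≠ q e) (hX : IsSpan p q (k i) (T i) e X) {v : α}
    (hv : v ∈ X) : IsReachEnd p q k T₀ e₀ v := by
  have hnot : ¬ X ⊆ {v} := fun hs =>
    hne ((mem_singleton.1 (hs hX.2.1)).trans (mem_singleton.1 (hs hX.2.2.1)).symm)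
  obtain ⟨f, hf, hfv⟩ := hX.1.exists_crossing hk hT (X := {v}) ⟨v, by simp [hv]⟩ hnot
  rw [mem_singleton, mem_singleton] at hfv
  exact ⟨_, f, h.step hX hf, hfv.imp And.left And.right⟩

/-- An edge of `T j` that crosses `W` could be made the left-over edge. Its span in `T i` would
then enlarge `W`. -/
lemma Reach.isSpan_subset (h : Reach p q k T₀ e₀ T e) (hij : i ≠ j) (hk : 1 ≤ k j)
    (hTi : Sparse p q (k i) (T i)) (hTj : Sparse p q (k j) (T j)) (hpW : p e ∈ W)
    (hW : Tight p q (k i) (T i) W)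
    (hmax : ∀ Z, (∀ v ∈ Z, v ∈ W ∨ IsReachEnd p q k T₀ e₀ v) → W ⊆ Z →
      Tight p q (k i) (T i) Z → Z ⊆ W)
    (hspan : ∀ {T e}, Reach p q k T₀ e₀ T e →
      ∃ X, IsSpan p q (k i) (T i) e X ∧ ∀ v ∈ X, IsReachEnd p q k T₀ e₀ v)
    (hX : IsSpan p q (k j) (T j) e X) : X ⊆ W := by
  by_contra hnot
  obtain ⟨f, hf, hfW⟩ := hX.1.exists_crossing hk hTj ⟨p e, mem_inter.2 ⟨hX.2.1, hpW⟩⟩ hnot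
  obtain ⟨Y, hY, hYend⟩ := hspan (h.step hX hf)
  rw [update_of_ne hij] at hY
  have hWY : (W ∩ Y).Nonempty := by
    rcases hfW with hfW | hfW
    exacts [⟨p f, mem_inter.2 ⟨hfW.1, hY.2.1⟩⟩, ⟨q f, mem_inter.2 ⟨hfW.2, hY.2.2.1⟩⟩]
  have hsub := hmax (W ∪ Y) (fun v hv => (mem_union.1 hv).imp_right (hYend v)) subset_union_left
    (hW.union_inter hY.1 hTi hWY).1
  have := hsub (mem_union_right _ hY.2.1)
  have := hsub (mem_union_right _ hY.2.2.1)
  tauto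

section Stuck

variable (hk : ∀ i, 1 ≤ k i) (hB : ∀ e ∈ B, p e ≠ q e) (he₀ : e₀ ∈ B)
  (h₀ : IsSparseDecomposition p q k (B.erase e₀) T₀)
  (hno : ¬ ∃ T, IsSparseDecomposition p q k B T)

include hk hB he₀ h₀ hno

lemma Reach.exists_isSpan (h : Reach p q k T₀ e₀ T e) (i : ι) :
    ∃ X, IsSpan p q (k i) (T i) e X ∧ ∀ v ∈ X, IsReachEnd p q k T₀ e₀ v := by
  obtain ⟨he, hdec⟩ := h.isSparseDecomposition he₀ h₀
  obtain ⟨X, hX⟩ := (hdec.spans he hno i).exists_isSpan (hdec.sparse i)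
  exact ⟨X, hX, fun v => h.isReachEnd_of_isSpan (hk i) (hdec.sparse i) (hB e he) hX⟩

lemma Reach.mem_of_maximal (hW : Tight p q (k i) (T₀ i) W) (hpW : p e₀ ∈ W) (hqW : q e₀ ∈ W)
    (hmax : ∀ Z, (∀ v ∈ Z, v ∈ W ∨ IsReachEnd p q k T₀ e₀ v) → W ⊆ Z →
      Tight p q (k i) (T₀ i) Z → Z ⊆ W)
    (h : Reach p q k T₀ e₀ T e) :
    (p e ∈ W ∧ q e ∈ W) ∧
      ∀ Z, W ⊆ Z → #(inside p q (T i) Z) = #(inside p q (T₀ i) Z) := by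
  induction h with
  | refl => exact ⟨⟨hpW, hqW⟩, fun _ _ => rfl⟩
  | @step T e j X f h hX hf ih =>
    obtain ⟨-, hdec⟩ := h.isSparseDecomposition he₀ h₀
    have hWT : Tight p q (k i) (T i) W := hW.of_card_inside_eq (ih.2 W Subset.rfl)
    have hXW : X ⊆ W := by
      obtain rfl | hij := eq_or_ne i j
      · exact hX.2.2.2 W hWT ih.1.1 ih.1.2
      · exact h.isSpan_subset hij (hk j) (hdec.sparse i) (hdec.sparse j) ih.1.1 hWT
          (fun Z hZ hWZ hZT => hmax Z hZ hWZ (hZT.of_card_inside_eq (ih.2 Z hWZ).symm))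
          (fun h => h.exists_isSpan hk hB he₀ h₀ hno i) hX
    have hfW := inside_mono Subset.rfl hXW hf
    refine ⟨(mem_inside.1 hfW).2, fun Z hWZ => ?_⟩
    obtain rfl | hij := eq_or_ne i j
    · have he : e ∉ T i := fun he => notMem_erase e B (hdec.subset i he)
      rw [update_self, card_inside_insert_erase (inside_mono Subset.rfl hWZ hfW) he
        ⟨hWZ ih.1.1, hWZ ih.1.2⟩, ih.2 Z hWZ]
    · rw [update_of_ne hij, ih.2 Z hWZ]

lemma tight_of_forall_mem_iff_isReachEnd (hU : ∀ v, v ∈ U ↔ IsReachEnd p q k T₀ e₀ v) (i : ι) :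
    Tight p q (k i) (T₀ i) U := by
  obtain ⟨X₀, hX₀, hX₀end⟩ := Reach.refl.exists_isSpan hk hB he₀ h₀ hno i
  classical
  obtain ⟨W, hW, hmax⟩ := (U.powerset.filter fun W =>
    Tight p q (k i) (T₀ i) W ∧ p e₀ ∈ W ∧ q e₀ ∈ W).exists_maximal
    ⟨X₀, by
      rw [mem_filter, mem_powerset]
      exact ⟨fun v hv => (hU v).2 (hX₀end v hv), hX₀.1, hX₀.2.1, hX₀.2.2.1⟩⟩
  simp only [mem_filter, mem_powerset] at hW hmax
  obtain ⟨hWU, hWtight, hpW, hqW⟩ := hW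
  have hUW : U ⊆ W := by
    intro v hv
    obtain ⟨T, e, hr, hev⟩ := (hU v).1 hv
    have heW := (hr.mem_of_maximal hk hB he₀ h₀ hno hWtight hpW hqW fun Z hZ hWZ hZT =>
      hmax ⟨fun v hv => (hZ v hv).elim (@hWU v) (hU v).2, hZT, hWZ hpW, hWZ hqW⟩ hWZ).1
    exact hev.mem heW
  rwa [hUW.antisymm hWU]

end Stuck

omit [DecidableEq β] [DecidableEq ι] in
/-- **Nash-Williams' theorem**, for pieces of arbitrary positive densities. If the pieces of
`B.erase e₀` cannot be modified to make room for `e₀`, then the vertex set touched by the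
left-over edges that can be reached is tight in all pieces, so that `B` has too many edges
there. -/
theorem Sparse.exists_isSparseDecomposition [Fintype ι] (hk : ∀ i, 1 ≤ k i)
    (hB : Sparse p q (∑ i, k i) B) : ∃ T, IsSparseDecomposition p q k B T := by
  classical
  induction B using Finset.induction_on with
  | empty => exact ⟨fun _ => ∅, fun _ => sparse_empty, fun _ _ _ => disjoint_empty_left _, by simp⟩
  | insert e₀ B he ih =>
    by_contra hno
    obtain ⟨T₀, hT₀⟩ := ih (hB.mono (subset_insert _ _))
    have h₀ : IsSparseDecomposition p q k ((insert e₀ B).erase e₀) T₀ := by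
      rwa [erase_insert he]
    have he₀ : e₀ ∈ insert e₀ B := mem_insert_self _ _
    let U : Finset α := (ends p q (insert e₀ B)).filter (IsReachEnd p q k T₀ e₀)
    have hU : ∀ v, v ∈ U ↔ IsReachEnd p q k T₀ e₀ v := by
      refine fun v => mem_filter.trans (and_iff_right_iff_imp.2 ?_)
      rintro ⟨T, e, hr, hev⟩
      exact mem_ends.2 ⟨e, (hr.isSparseDecomposition he₀ h₀).1, hev⟩
    have hpU : p e₀ ∈ U := (hU _).2 ⟨_, _, .refl, .inl rfl⟩
    have hqU : q e₀ ∈ U := (hU _).2 ⟨_, _, .refl, .inr rfl⟩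
    have htight := tight_of_forall_mem_iff_isReachEnd hk (fun e he => hB.ne he) he₀ h₀ hno hU
    have heq := hT₀.inside_eq_of_tight hB (subset_insert _ _) htight ⟨_, hpU⟩
    have he₀U : e₀ ∈ inside p q (insert e₀ B) U := mem_inside.2 ⟨he₀, hpU, hqU⟩
    rw [heq] at he₀U
    exact he (inside_subset he₀U)

end Decomposition

/-! ### Maximum matchings in the complement -/

section Matchings

variable {α β : Type*}

/-- No edge of `M` ends in `v`. -/
def Misses (p q : β → α) (M : Finset β) (v : α) : Prop := ∀ e ∈ M, ¬ Inc p q e v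

/-- `M` and `M'` have the same edges apart from those inside `R`. -/
def AgreeOff (p q : β → α) (M M' : Finset β) (R : Finset α) : Prop :=
  ∀ e, ¬ (p e ∈ R ∧ q e ∈ R) → (e ∈ M ↔ e ∈ M')

variable [DecidableEq α] [DecidableEq β]

/-- `M ⊆ N` is a matching that avoids the vertex `u` and whose union with `B` is sparse. -/
structure Feasible (p q : β → α) (m : ℕ) (B N : Finset β) (u : α) (M : Finset β) : Prop where
  subset : M ⊆ N
  eq_of_inc : ∀ e ∈ M, ∀ f ∈ M, ∀ v, Inc p q e v → Inc p q f v → e = f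
  misses : Misses p q M u
  sparse : Sparse p q m (B ∪ M)

/-- `M'` is a feasible matching as large as `M` that misses the vertex `x` of `X` and differs from
`M` only inside `X`. -/
structure Frees (p q : β → α) (m : ℕ) (B N : Finset β) (u : α) (M : Finset β) (x : α)
    (X : Finset α) (M' : Finset β) : Prop where
  mem : x ∈ X
  feasible : Feasible p q m B N u M'
  card_eq : #M' = #M
  misses : Misses p q M' x
  agreeOff : AgreeOff p q M' M X

/-- `W` contains all vertices that `M` could miss, and every vertex of `W` can be missed by a
matching as large as `M` that differs from `M` only inside a tight set around that vertex. -/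
structure Freeable (p q : β → α) (m : ℕ) (B N : Finset β) (u : α) (V : Finset α) (M : Finset β)
    (W : Finset α) : Prop where
  subset : W ⊆ V
  notMem : u ∉ W
  mem_of_misses : ∀ v ∈ V, v ≠ u → Misses p q M v → v ∈ W
  exists_frees : ∀ x ∈ W, ∃ X M', Tight p q m (B ∪ inside p q M W) X ∧ Frees p q m B N u M x X M'

/-- `M₁` with its edges inside `Y` replaced by those of `M₂`. -/
def splice (p q : β → α) (M₁ M₂ : Finset β) (Y : Finset α) : Finset β :=
  (M₁ \ inside p q M₁ Y) ∪ inside p q M₂ Y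

variable {p q : β → α} {m : ℕ} {B N M M' M₁ M₂ : Finset β} {u x y v : α}
  {R T X Y Z W V : Finset α} {e f : β}

omit [DecidableEq β] in
lemma AgreeOff.card_inside (h : AgreeOff p q M M' R) (hcard : #M = #M') (hRZ : R ⊆ Z) :
    #(inside p q M Z) = #(inside p q M' Z) := by
  classical
  have hsdiff : M \ inside p q M Z = M' \ inside p q M' Z := by
    ext e
    have := h e
    simp only [mem_sdiff, mem_inside]
    grind
  have hM := card_sdiff_add_card_eq_card (inside_subset (p := p) (q := q) (B := M) (X := Z))
  have hM' := card_sdiff_add_card_eq_card (inside_subset (p := p) (q := q) (B := M') (X := Z))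
  rw [hsdiff] at hM
  lia

omit [DecidableEq β] in
lemma AgreeOff.inside_eq (h : AgreeOff p q M M' R) (hRZ : Disjoint R Z) :
    inside p q M Z = inside p q M' Z := by
  ext e
  simp only [mem_inside, and_congr_left_iff]
  exact fun he => h e fun heR => disjoint_left.1 hRZ heR.1 he.1

lemma Tight.congr_matching (hZ : Tight p q m (B ∪ M) Z) (hBM : Disjoint B M)
    (hBM' : Disjoint B M') (h : #(inside p q M Z) = #(inside p q M' Z)) :
    Tight p q m (B ∪ M') Z := by
  refine hZ.of_card_inside_eq ?_
  rw [inside_union_edges, inside_union_edges,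
    card_union_of_disjoint (hBM.mono inside_subset inside_subset),
    card_union_of_disjoint (hBM'.mono inside_subset inside_subset), h]

lemma mem_splice : e ∈ splice p q M₁ M₂ Y ↔
    (e ∈ M₂ ∧ p e ∈ Y ∧ q e ∈ Y) ∨ (e ∈ M₁ ∧ ¬ (p e ∈ Y ∧ q e ∈ Y)) := by
  simp only [splice, mem_union, mem_sdiff, mem_inside]
  tauto

lemma agreeOff_splice : AgreeOff p q (splice p q M₁ M₂ Y) M₁ Y := fun e he => by
  rw [mem_splice]
  tauto

lemma inside_splice : inside p q (splice p q M₁ M₂ Y) Y = inside p q M₂ Y := by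
  ext e
  simp only [mem_inside, mem_splice]
  tauto

lemma card_splice (h : #(inside p q M₁ Y) = #(inside p q M₂ Y)) :
    #(splice p q M₁ M₂ Y) = #M₁ := by
  rw [splice, card_union_of_disjoint, ← h, card_sdiff_add_card_eq_card inside_subset]
  rw [disjoint_left]
  intro e he₁ he₂
  rw [mem_sdiff, mem_inside] at he₁
  exact he₁.2 ⟨he₁.1, (mem_inside.1 he₂).2⟩

lemma Misses.splice_left (h : Misses p q M₁ x) (hx : x ∉ Y) :
    Misses p q (splice p q M₁ M₂ Y) x := fun e he hinc =>
  (mem_splice.1 he).elim (fun he₂ => hx (hinc.mem he₂.2)) fun he₁ => h e he₁.1 hinc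

lemma Misses.splice_right (h : Misses p q M₂ y)
    (hboundary : ∀ e, ¬ (p e ∈ Y ∧ q e ∈ Y) → Inc p q e y → (e ∈ M₁ ↔ e ∈ M₂)) :
    Misses p q (splice p q M₁ M₂ Y) y := fun e he hinc =>
  (mem_splice.1 he).elim (fun he₂ => h e he₂.1 hinc)
    fun he₁ => h e ((hboundary e he₁.2 hinc).1 he₁.1) hinc

protected lemma Feasible.splice (h₁ : Feasible p q m B N u M₁) (h₂ : Feasible p q m B N u M₂)
    (hY : Tight p q m (B ∪ M₁) Y)
    (hboundary : ∀ e, ¬ (p e ∈ Y ∧ q e ∈ Y) → ∀ v ∈ Y, Inc p q e v → (e ∈ M₁ ↔ e ∈ M₂)) :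
    Feasible p q m B N u (splice p q M₁ M₂ Y) := by
  refine ⟨fun e he => ?_, ?_, fun e he => ?_, ?_⟩
  · exact (mem_splice.1 he).elim (fun h => h₂.subset h.1) fun h => h₁.subset h.1
  · have hmixed : ∀ e f v, (e ∈ M₂ ∧ p e ∈ Y ∧ q e ∈ Y) → (f ∈ M₁ ∧ ¬ (p f ∈ Y ∧ q f ∈ Y)) →
        Inc p q e v → Inc p q f v → e = f := fun e f v he hf hev hfv =>
      h₂.eq_of_inc e he.1 f ((hboundary f hf.2 v (hev.mem he.2) hfv).1 hf.1) v hev hfv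
    intro e he f hf v hev hfv
    rcases mem_splice.1 he with he | he <;> rcases mem_splice.1 hf with hf | hf
    · exact h₂.eq_of_inc e he.1 f hf.1 v hev hfv
    · exact hmixed e f v he hf hev hfv
    · exact (hmixed f e v hf he hfv hev).symm
    · exact h₁.eq_of_inc e he.1 f hf.1 v hev hfv
  · exact (mem_splice.1 he).elim (fun h => h₂.misses e h.1) fun h => h₁.misses e h.1
  · refine (h₁.sparse.sdiff_inside_union hY h₂.sparse).mono fun e he => ?_
    simp only [mem_union, mem_splice, mem_sdiff, mem_inside] at he ⊢
    tauto

lemma Feasible.exists_frees_both (hBN : Disjoint B N) (hM : Feasible p q m B N u M)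
    (hXY : Disjoint X Y) (hX : Tight p q m (B ∪ M) X) (hY : Tight p q m (B ∪ M) Y)
    (h₁ : Frees p q m B N u M x X M₁) (h₂ : Frees p q m B N u M y Y M₂) :
    ∃ K, Feasible p q m B N u K ∧ #K = #M ∧ Misses p q K x ∧ Misses p q K y ∧
      (∀ e, ¬ (p e ∈ X ∧ q e ∈ X) → ¬ (p e ∈ Y ∧ q e ∈ Y) → (e ∈ K ↔ e ∈ M)) ∧
      Tight p q m (B ∪ K) X ∧ Tight p q m (B ∪ K) Y := by
  have hboundary : ∀ e, ¬ (p e ∈ Y ∧ q e ∈ Y) → ∀ v ∈ Y, Inc p q e v → (e ∈ M₁ ↔ e ∈ M₂) :=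
    fun e heY v hv hinc => (h₁.agreeOff e fun heX =>
      disjoint_left.1 hXY (hinc.mem heX) hv).trans (h₂.agreeOff e heY).symm
  have hBM := hBN.mono_right hM.subset
  have hBM₁ := hBN.mono_right h₁.feasible.subset
  have hinside₁ : inside p q M₁ Y = inside p q M Y := h₁.agreeOff.inside_eq hXY
  have hinside₂ : #(inside p q M₂ Y) = #(inside p q M Y) :=
    h₂.agreeOff.card_inside h₂.card_eq Subset.rfl
  have hY₁ : Tight p q m (B ∪ M₁) Y := hY.congr_matching hBM hBM₁ (by rw [hinside₁])
  have hX₁ : Tight p q m (B ∪ M₁) X := hX.congr_matching hBM hBM₁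
    (h₁.agreeOff.card_inside h₁.card_eq Subset.rfl).symm
  have hK := h₁.feasible.splice h₂.feasible hY₁ hboundary
  have hBK := hBN.mono_right hK.subset
  refine ⟨splice p q M₁ M₂ Y, hK, ?_, ?_, ?_, ?_, ?_, ?_⟩
  · rw [card_splice (by rw [hinside₁, hinside₂]), h₁.card_eq]
  · exact h₁.misses.splice_left (disjoint_left.1 hXY h₁.mem)
  · exact h₂.misses.splice_right fun e he => hboundary e he y h₂.mem
  · exact fun e heX heY => (agreeOff_splice e heY).trans (h₁.agreeOff e heX)
  · exact hX₁.congr_matching hBM₁ hBK (by rw [agreeOff_splice.inside_eq hXY.symm])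
  · exact hY.congr_matching hBM hBK (by rw [inside_splice, hinside₂])

protected lemma Feasible.insert (hM : Feasible p q m B N u M) (he : e ∈ N) (heu : ¬ Inc p q e u)
    (hpe : Misses p q M (p e)) (hqe : Misses p q M (q e))
    (hs : Sparse p q m (insert e (B ∪ M))) : Feasible p q m B N u (insert e M) := by
  have hfree : ∀ g ∈ M, ∀ v, Inc p q g v → ¬ Inc p q e v := by
    rintro g hg v hgv (rfl | rfl)
    exacts [hpe g hg hgv, hqe g hg hgv]
  refine ⟨insert_subset he hM.subset, fun g hg f hf v hgv hfv => ?_, fun g hg => ?_, ?_⟩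
  · rcases mem_insert.1 hg with rfl | hgM <;> rcases mem_insert.1 hf with rfl | hfM
    · rfl
    · exact absurd hgv (hfree f hfM v hfv)
    · exact absurd hfv (hfree g hgM v hgv)
    · exact hM.eq_of_inc g hgM f hfM v hgv hfv
  · rcases mem_insert.1 hg with rfl | hg
    exacts [heu, hM.misses g hg]
  · rwa [union_insert]

lemma Feasible.spans_of_maximal (hM : Feasible p q m B N u M)
    (hmax : ∀ M', Feasible p q m B N u M' → #M' ≤ #M) (he : e ∈ N) (heu : ¬ Inc p q e u)
    (hpe : Misses p q M (p e)) (hqe : Misses p q M (q e)) : Spans p q m (B ∪ M) e :=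
  spans_of_not_sparse_insert hM.sparse fun hs => by
    have hle := hmax _ (hM.insert he heu hpe hqe hs)
    rw [card_insert_of_notMem fun h => hpe e h (.inl rfl)] at hle
    lia

lemma Feasible.mono (hM : Feasible p q m B N u M) (h : M' ⊆ M) : Feasible p q m B N u M' :=
  ⟨h.trans hM.subset, fun e he f hf => hM.eq_of_inc e (h he) f (h hf),
    fun e he => hM.misses e (h he), hM.sparse.mono (union_subset_union_right h)⟩

lemma Feasible.frees_insert_erase {K : Finset β} (hBN : Disjoint B N)
    (hK : Feasible p q m B N u K) (hcard : #K = #M) (hagree : AgreeOff p q K M Z) (he : e ∈ N)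
    (heu : ¬ Inc p q e u) (hpe : Misses p q K (p e)) (hqe : Misses p q K (q e))
    (hT : IsSpan p q m (B ∪ K) e T) (hTZ : T ⊆ Z) (hf : f ∈ K) (hfT : p f ∈ T ∧ q f ∈ T)
    (hfv : Inc p q f v) (hev : ¬ Inc p q e v) :
    Frees p q m B N u M v Z (insert e (K.erase f)) := by
  have heK : e ∉ K := fun heK => hpe e heK (.inl rfl)
  have heB : e ∉ B := fun heB => disjoint_left.1 hBN heB he
  have hfB : f ∉ B := fun hfB => disjoint_left.1 hBN hfB (hK.subset hf)
  have hsparse := hT.sparse_insert_erase hK.sparse (by simp [heB, heK])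
    (mem_inside.2 ⟨mem_union_right B hf, hfT⟩)
  rw [erase_union_distrib, erase_eq_of_notMem hfB] at hsparse
  refine ⟨hTZ (hfv.mem hfT), (hK.mono (erase_subset _ _)).insert he heu
    (fun g hg => hpe g (mem_of_mem_erase hg)) (fun g hg => hqe g (mem_of_mem_erase hg)) hsparse,
    ?_, fun g hg hgv => ?_, fun g hg => ?_⟩
  · rw [card_insert_of_notMem (by simp [heK]), card_erase_add_one hf, hcard]
  · rcases mem_insert.1 hg with rfl | hg
    · exact hev hgv
    · rw [mem_erase] at hg
      exact hg.1 (hK.eq_of_inc g hg.2 f hf v hgv hfv)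
  · have hge : g ≠ e := by
      rintro rfl
      exact hg ⟨hTZ hT.2.1, hTZ hT.2.2.1⟩
    have hgf : g ≠ f := by
      rintro rfl
      exact hg ⟨hTZ hfT.1, hTZ hfT.2⟩
    rw [← hagree g hg]
    simp [hge, hgf]

lemma not_inside_of_tight (hBM : Disjoint B M) (hsparse : Sparse p q m (B ∪ M))
    (hX : Tight p q m (B ∪ inside p q M W) X) (hf : f ∈ M) (hfv : Inc p q f v) (hv : v ∉ W) :
    ¬ (p f ∈ X ∧ q f ∈ X) := by
  intro hfX
  have hmem : f ∈ inside p q (B ∪ M) X := mem_inside.2 ⟨mem_union_right B hf, hfX⟩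
  rw [hX.inside_eq (union_subset_union_right inside_subset) hsparse, mem_inside, mem_union,
    mem_inside] at hmem
  exact hv (hfv.mem (hmem.1.resolve_left (disjoint_right.1 hBM hf)).2)

lemma Tight.of_ends_subset (hZ : Tight p q m (B ∪ M) Z) (h : ends p q (inside p q M Z) ⊆ W) :
    Tight p q m (B ∪ inside p q M W) Z := by
  have hinside : inside p q (B ∪ inside p q M W) Z = inside p q (B ∪ M) Z := by
    ext e
    have hends : e ∈ M → p e ∈ Z ∧ q e ∈ Z → p e ∈ W ∧ q e ∈ W := fun he heZ =>
      ⟨h (mem_ends.2 ⟨e, mem_inside.2 ⟨he, heZ⟩, .inl rfl⟩),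
        h (mem_ends.2 ⟨e, mem_inside.2 ⟨he, heZ⟩, .inr rfl⟩)⟩
    simp only [mem_inside, mem_union]
    tauto
  exact hZ.of_card_inside_eq (by rw [hinside])

/-- After freeing both ends of `e` at once, `e` must have a span by the maximality of `M`, and
every matching edge of the span can be exchanged for `e`. -/
lemma Freeable.exists_tight_frees (hBN : Disjoint B N) (hM : Feasible p q m B N u M)
    (hmax : ∀ M', Feasible p q m B N u M' → #M' ≤ #M)
    (hW : Freeable p q m B N u V M W) (he : e ∈ N) (hp : p e ∈ W) (hq : q e ∈ W)
    (hno : ¬ Spans p q m (B ∪ inside p q M W) e) :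
    ∃ Z, Tight p q m (B ∪ M) Z ∧ p e ∈ Z ∧ q e ∈ Z ∧
      ∀ v ∈ ends p q (inside p q M Z), v ∉ W → ∃ M', Frees p q m B N u M v Z M' := by
  obtain ⟨X, Mx, hX, hMx⟩ := hW.exists_frees _ hp
  obtain ⟨Y, My, hY, hMy⟩ := hW.exists_frees _ hq
  have hAB : B ∪ inside p q M W ⊆ B ∪ M := union_subset_union_right inside_subset
  have hXY := hX.disjoint_of_not_spans hY (hM.sparse.mono hAB) hMx.mem hMy.mem hno
  obtain ⟨K, hK, hcard, hKp, hKq, hagree, hXK, hYK⟩ := hM.exists_frees_both hBN hXY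
    (hX.mono hAB hM.sparse) (hY.mono hAB hM.sparse) hMx hMy
  have heu : ¬ Inc p q e u := fun h => hW.notMem (by rcases h with h | h <;> rwa [← h])
  obtain ⟨T, hT⟩ := (hK.spans_of_maximal (hcard ▸ hmax) he heu hKp hKq).exists_isSpan hK.sparse
  have hTX : (T ∩ X).Nonempty := ⟨p e, mem_inter.2 ⟨hT.2.1, hMx.mem⟩⟩
  have hTXY : ((T ∪ X) ∩ Y).Nonempty :=
    ⟨q e, mem_inter.2 ⟨mem_union_left _ hT.2.2.1, hMy.mem⟩⟩
  have htTX := (hT.1.union_inter hXK hK.sparse hTX).1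
  have htZ := (htTX.union_inter hYK hK.sparse hTXY).1
  have hTZ : T ⊆ T ∪ X ∪ Y := subset_union_left.trans subset_union_left
  have hagreeZ : AgreeOff p q K M (T ∪ X ∪ Y) := fun g hg => hagree g
    (fun h => hg (by simp [h])) (fun h => hg (by simp [h]))
  refine ⟨T ∪ X ∪ Y, htZ.congr_matching (hBN.mono_right hK.subset) (hBN.mono_right hM.subset)
    (hagreeZ.card_inside hcard Subset.rfl), hTZ hT.2.1, hTZ hT.2.2.1, fun v hv hvW => ?_⟩
  obtain ⟨f, hf, hfv⟩ := mem_ends.1 hv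
  obtain ⟨hfM, hfZ⟩ := mem_inside.1 hf
  have hfX := not_inside_of_tight (hBN.mono_right hM.subset) hM.sparse hX hfM hfv hvW
  have hfY := not_inside_of_tight (hBN.mono_right hM.subset) hM.sparse hY hfM hfv hvW
  have hfK : f ∈ K := (hagree f hfX hfY).2 hfM
  have hfT : p f ∈ T ∧ q f ∈ T := by
    have hmem := mem_inside.2 ⟨mem_union_right B hfK, hfZ⟩
    rw [htTX.inside_union hYK hK.sparse hTXY, hT.1.inside_union hXK hK.sparse hTX] at hmem
    simp only [mem_union, mem_inside, hfX, hfY, and_false, or_false] at hmem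
    exact hmem.2
  exact ⟨_, hK.frees_insert_erase hBN hcard hagreeZ he heu hKp hKq hT hTZ hfK hfT hfv
    fun h => hvW (by rcases h with h | h <;> rwa [← h])⟩

lemma Freeable.exists_ssuperset (hBN : Disjoint B N) (hN : ∀ e ∈ N, p e ∈ V ∧ q e ∈ V)
    (hM : Feasible p q m B N u M) (hmax : ∀ M', Feasible p q m B N u M' → #M' ≤ #M)
    (hW : Freeable p q m B N u V M W) (he : e ∈ N) (hp : p e ∈ W) (hq : q e ∈ W)
    (hno : ¬ Spans p q m (B ∪ inside p q M W) e) :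
    ∃ W', Freeable p q m B N u V M W' ∧ W ⊂ W' := by
  obtain ⟨Z, hZ, hpZ, hqZ, hfrees⟩ := hW.exists_tight_frees hBN hM hmax he hp hq hno
  have hWW' : W ⊆ W ∪ ends p q (inside p q M Z) := subset_union_left
  refine ⟨W ∪ ends p q (inside p q M Z), ⟨?_, ?_, ?_, fun v hv => ?_⟩, ?_⟩
  · refine union_subset hW.subset fun v hv => ?_
    obtain ⟨f, hf, hfv⟩ := mem_ends.1 hv
    exact hfv.mem (hN f (hM.subset (inside_subset hf)))
  · rw [notMem_union]
    refine ⟨hW.notMem, fun hu => ?_⟩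
    obtain ⟨f, hf, hfu⟩ := mem_ends.1 hu
    exact hM.misses f (inside_subset hf) hfu
  · exact fun v hv hvu hmiss => hWW' (hW.mem_of_misses v hv hvu hmiss)
  · by_cases hvW : v ∈ W
    · obtain ⟨X, M', hX, hM'⟩ := hW.exists_frees v hvW
      exact ⟨X, M', hX.mono (union_subset_union_right (inside_mono Subset.rfl hWW'))
        (hM.sparse.mono (union_subset_union_right inside_subset)), hM'⟩
    · obtain ⟨M', hM'⟩ := hfrees v ((mem_union.1 hv).resolve_left hvW) hvW
      exact ⟨Z, M', hZ.of_ends_subset subset_union_right, hM'⟩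
  · refine hWW'.ssubset_of_ne fun heq => hno ⟨Z, hZ.of_ends_subset ?_, hpZ, hqZ⟩
    rw [heq]
    exact subset_union_right

lemma Feasible.freeable_filter_misses (hM : Feasible p q m B N u M)
    [DecidablePred (Misses p q M)] :
    Freeable p q m B N u V M (V.filter fun v => v ≠ u ∧ Misses p q M v) := by
  refine ⟨filter_subset _ _, by simp, fun v hv hvu hmiss => mem_filter.2 ⟨hv, hvu, hmiss⟩,
    fun x hx => ?_⟩
  exact ⟨{x}, M, (hM.sparse.mono (union_subset_union_right inside_subset)).tight_singleton x,
    mem_singleton_self x, hM, rfl, (mem_filter.1 hx).2.2, fun _ _ => Iff.rfl⟩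

theorem Feasible.exists_freeable (hBN : Disjoint B N) (hN : ∀ e ∈ N, p e ∈ V ∧ q e ∈ V)
    (hM : Feasible p q m B N u M) (hmax : ∀ M', Feasible p q m B N u M' → #M' ≤ #M) :
    ∃ W, Freeable p q m B N u V M W ∧
      ∀ e ∈ N, p e ∈ W → q e ∈ W → Spans p q m (B ∪ inside p q M W) e := by
  classical
  obtain ⟨W, hWmax⟩ := (V.powerset.filter fun W => Freeable p q m B N u V M W).exists_maximal
    ⟨_, mem_filter.2 ⟨mem_powerset.2 (filter_subset _ _), hM.freeable_filter_misses⟩⟩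
  refine ⟨W, (mem_filter.1 hWmax.prop).2, fun e he hp hq => ?_⟩
  by_contra hno
  obtain ⟨W', hW', hlt⟩ :=
    (mem_filter.1 hWmax.prop).2.exists_ssuperset hBN hN hM hmax he hp hq hno
  exact hWmax.not_gt (mem_filter.2 ⟨mem_powerset.2 hW'.subset, hW'⟩) hlt

end Matchings

/-! ### Partitions into maximal tight sets -/

section Partitions

variable {α β : Type*} [DecidableEq α]

/-- The edges `e` of `B` with `p e ∈ X` and `q e ∈ Y`. -/
def links (p q : β → α) (B : Finset β) (X Y : Finset α) : Finset β :=
  B.filter fun e => p e ∈ X ∧ q e ∈ Y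

/-- The number of edges of `B` between `X` and `Y`; edges inside `X ∩ Y` are counted twice. -/
def between (p q : β → α) (B : Finset β) (X Y : Finset α) : ℕ :=
  #(links p q B X Y) + #(links p q B Y X)

/-- The number of edges of `B` with exactly one end in `X`. -/
def boundary (p q : β → α) (B : Finset β) (X : Finset α) : ℕ :=
  #(B.filter fun e => (p e ∈ X ∧ q e ∉ X) ∨ (p e ∉ X ∧ q e ∈ X))

/-- The edges of `B` that are not inside a block of `P`. -/
def crossing (p q : β → α) {V : Finset α} (P : Finpartition V) (B : Finset β) : Finset β :=
  B.filter fun e => ∀ C ∈ P.parts, ¬ (p e ∈ C ∧ q e ∈ C)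

/-- The blocks of `P` are the maximal tight subsets of `V`. -/
structure IsTightPartition (p q : β → α) (k : ℕ) (B : Finset β) {V : Finset α}
    (P : Finpartition V) : Prop where
  tight : ∀ C ∈ P.parts, Tight p q k B C
  exists_superset : ∀ T, Tight p q k B T → T ⊆ V → ∃ C ∈ P.parts, T ⊆ C

variable {p q : β → α} {k : ℕ} {B B' : Finset β} {V X X' Y Y' T : Finset α} {P : Finpartition V}
  {Q : Finset (Finset α)} {e : β} {v : α}

lemma mem_links : e ∈ links p q B X Y ↔ e ∈ B ∧ p e ∈ X ∧ q e ∈ Y := by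
  simp [links]

lemma mem_crossing : e ∈ crossing p q P B ↔ e ∈ B ∧ ∀ C ∈ P.parts, ¬ (p e ∈ C ∧ q e ∈ C) := by
  simp [crossing]

lemma links_mono (hX : X ⊆ X') (hY : Y ⊆ Y') : links p q B X Y ⊆ links p q B X' Y' :=
  fun e he => by
    rw [mem_links] at he ⊢
    exact ⟨he.1, hX he.2.1, hY he.2.2⟩

lemma between_mono (hX : X ⊆ X') (hY : Y ⊆ Y') : between p q B X Y ≤ between p q B X' Y' :=
  Nat.add_le_add (card_le_card (links_mono hX hY)) (card_le_card (links_mono hY hX))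

lemma between_comm : between p q B X Y = between p q B Y X := Nat.add_comm _ _

lemma between_self : between p q B X X = 2 * #(inside p q B X) := (two_mul _).symm

lemma card_links_union_left (h : Disjoint X X') :
    #(links p q B (X ∪ X') Y) = #(links p q B X Y) + #(links p q B X' Y) := by
  classical
  have hunion : links p q B (X ∪ X') Y = links p q B X Y ∪ links p q B X' Y := by
    ext e
    simp only [mem_links, mem_union]
    tauto
  rw [hunion, card_union_of_disjoint]
  refine disjoint_left.2 fun e he he' => disjoint_left.1 h (mem_links.1 he).2.1 ?_
  exact (mem_links.1 he').2.1

lemma card_links_union_right (h : Disjoint Y Y') :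
    #(links p q B X (Y ∪ Y')) = #(links p q B X Y) + #(links p q B X Y') := by
  classical
  have hunion : links p q B X (Y ∪ Y') = links p q B X Y ∪ links p q B X Y' := by
    ext e
    simp only [mem_links, mem_union]
    tauto
  rw [hunion, card_union_of_disjoint]
  refine disjoint_left.2 fun e he he' => disjoint_left.1 h (mem_links.1 he).2.2 ?_
  exact (mem_links.1 he').2.2

lemma between_union_left (h : Disjoint X X') :
    between p q B (X ∪ X') Y = between p q B X Y + between p q B X' Y := by
  rw [between, card_links_union_left h, card_links_union_right h, between, between]
  ring

lemma between_union_right (h : Disjoint Y Y') :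
    between p q B X (Y ∪ Y') = between p q B X Y + between p q B X Y' := by
  rw [between_comm, between_union_left h, between_comm, between_comm (X := Y')]

lemma sum_between (hQ : (Q : Set (Finset α)).PairwiseDisjoint id) :
    ∑ C ∈ Q, between p q B C Y = between p q B (Q.biUnion id) Y := by
  induction Q using Finset.induction_on with
  | empty => simp [between, links]
  | insert C Q hC ih =>
    rw [coe_insert, Set.pairwiseDisjoint_insert_of_notMem (by simpa using hC)] at hQ
    rw [sum_insert hC, ih hQ.1, biUnion_insert, between_union_left, id]
    rw [disjoint_biUnion_right]
    exact fun D hD => hQ.2 D hD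

lemma card_le_between
    (h : ∀ v ∈ X, ∃ e ∈ B, (p e = v ∧ q e ∈ Y) ∨ (q e = v ∧ p e ∈ Y)) :
    #X ≤ between p q B X Y := by
  have hsub : X ⊆ (links p q B X Y).image p ∪ (links p q B Y X).image q := by
    intro v hv
    simp only [mem_union, mem_image, mem_links]
    obtain ⟨e, he, ⟨rfl, hq⟩ | ⟨rfl, hp⟩⟩ := h v hv
    exacts [.inl ⟨e, ⟨he, hv, hq⟩, rfl⟩, .inr ⟨e, ⟨he, hp, hv⟩, rfl⟩]
  exact (card_le_card hsub).trans ((card_union_le _ _).trans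
    (Nat.add_le_add card_image_le card_image_le))

lemma exists_isTightPartition (hB : Sparse p q k B) (V : Finset α) :
    ∃ P : Finpartition V, IsTightPartition p q k B P := by
  classical
  set 𝒯 := V.powerset.filter (Tight p q k B)
  have hmem : ∀ {T}, T ∈ 𝒯 ↔ T ⊆ V ∧ Tight p q k B T := by simp [𝒯]
  have hsup : ∀ T ∈ 𝒯, ∃ C ∈ 𝒯.filter (Maximal (· ∈ 𝒯)), T ⊆ C := by
    intro T hT
    obtain ⟨C, hTC, hC⟩ := 𝒯.exists_le_maximal hT
    exact ⟨C, mem_filter.2 ⟨hC.prop, hC⟩, hTC⟩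
  have hunique : ∀ C D v, Maximal (· ∈ 𝒯) C → Maximal (· ∈ 𝒯) D → v ∈ C → v ∈ D → C = D := by
    intro C D v hC hD hvC hvD
    obtain ⟨hCV, hCtight⟩ := hmem.1 hC.prop
    obtain ⟨hDV, hDtight⟩ := hmem.1 hD.prop
    have hCD : C ∪ D ∈ 𝒯 := hmem.2 ⟨union_subset hCV hDV,
      (hCtight.union_inter hDtight hB ⟨v, mem_inter.2 ⟨hvC, hvD⟩⟩).1⟩
    exact (hC.eq_of_le hCD subset_union_left).trans (hD.eq_of_le hCD subset_union_right).symm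
  refine ⟨.ofExistsUnique (𝒯.filter (Maximal (· ∈ 𝒯))) ?_ ?_ ?_, ?_, ?_⟩
  · exact fun C hC => (hmem.1 (mem_filter.1 hC).1).1
  · intro v hv
    obtain ⟨C, hC, hvC⟩ := hsup {v} (hmem.2 ⟨by simpa using hv, hB.tight_singleton v⟩)
    rw [singleton_subset_iff] at hvC
    exact ⟨C, ⟨hC, hvC⟩, fun D hD =>
      hunique D C v (mem_filter.1 hD.1).2 (mem_filter.1 hC).2 hD.2 hvC⟩
  · exact fun h => (hmem.1 (mem_filter.1 h).1).2.1.ne_empty rfl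
  · exact fun C hC => (hmem.1 (mem_filter.1 hC).1).2
  · exact fun T hT hTV => hsup T (hmem.2 ⟨hTV, hT⟩)

lemma pairwiseDisjoint_of_subset_parts (hQ : Q ⊆ P.parts) :
    (Q : Set (Finset α)).PairwiseDisjoint id :=
  P.disjoint.subset (mod_cast hQ)

lemma inside_crossing_block {C : Finset α} (hC : C ∈ P.parts) :
    inside p q (crossing p q P B) C = ∅ :=
  filter_eq_empty_iff.2 fun _ he => (mem_crossing.1 he).2 C hC

lemma IsTightPartition.maximal (hP : IsTightPartition p q k B P) {C : Finset α}
    (hC : C ∈ P.parts) : Maximal (fun T => Tight p q k B T ∧ T ⊆ V) C := by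
  refine ⟨⟨hP.tight C hC, P.subset hC⟩, fun T hT hCT => ?_⟩
  obtain ⟨D, hD, hTD⟩ := hP.exists_superset T hT.1 hT.2
  obtain ⟨v, hv⟩ := P.nonempty_of_mem_parts hC
  rwa [P.eq_of_mem_parts hC hD hv (hTD (hCT hv))]

lemma card_inside_biUnion (hQ : Q ⊆ P.parts) :
    #(inside p q B (Q.biUnion id)) =
      ∑ C ∈ Q, #(inside p q B C) + #(inside p q (crossing p q P B) (Q.biUnion id)) := by
  classical
  have hsplit : inside p q B (Q.biUnion id) =
      Q.biUnion (inside p q B) ∪ inside p q (crossing p q P B) (Q.biUnion id) := by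
    ext e
    simp only [mem_union, mem_inside, mem_crossing, mem_biUnion, id]
    constructor
    · rintro ⟨heB, hp, hq⟩
      refine or_iff_not_imp_left.2 fun h => ⟨⟨heB, fun C hC hCe => h ?_⟩, hp, hq⟩
      obtain ⟨D, hD, hpD⟩ := hp
      rw [P.eq_of_mem_parts hC (hQ hD) hCe.1 hpD] at hCe
      exact ⟨D, hD, heB, hCe⟩
    · rintro (⟨C, hC, heB, hpC, hqC⟩ | ⟨he, hpq⟩)
      exacts [⟨heB, ⟨C, hC, hpC⟩, ⟨C, hC, hqC⟩⟩, ⟨he.1, hpq⟩]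
  rw [hsplit, card_union_of_disjoint, card_biUnion]
  · intro C hC D hD hne
    exact disjoint_left.2 fun e heC heD =>
      disjoint_left.1 (P.disjoint (hQ hC) (hQ hD) hne) (mem_inside.1 heC).2.1 (mem_inside.1 heD).2.1
  · rw [disjoint_left]
    intro e he he'
    obtain ⟨C, hC, heC⟩ := mem_biUnion.1 he
    exact (mem_crossing.1 (inside_subset he')).2 C (hQ hC) (mem_inside.1 heC).2

lemma IsTightPartition.card_inside (hP : IsTightPartition p q k B P) (hQ : Q ⊆ P.parts) :
    #(inside p q B (Q.biUnion id)) + k * #Q =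
      k * #(Q.biUnion id) + #(inside p q (crossing p q P B) (Q.biUnion id)) := by
  have hsum : ∑ C ∈ Q, #(inside p q B C) + k * #Q = k * #(Q.biUnion id) := by
    rw [card_biUnion (pairwiseDisjoint_of_subset_parts hQ), mul_sum, mul_comm, ← smul_eq_mul,
      ← sum_const, ← sum_add_distrib]
    exact sum_congr rfl fun C hC => (hP.tight C (hQ hC)).2
  rw [card_inside_biUnion hQ, ← hsum]
  ring

lemma Tight.subset_of_mem (hT : Tight p q k B T) (hk : 1 ≤ k)
    (hB : Sparse p q k B) (hV : ∀ e ∈ B, p e ∈ V ∧ q e ∈ V) (hvT : v ∈ T) (hvV : v ∈ V) :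
    T ⊆ V := by
  by_contra hnot
  obtain ⟨f, hf, h⟩ := hT.exists_crossing hk hB ⟨v, mem_inter.2 ⟨hvT, hvV⟩⟩ hnot
  have := hV f (inside_subset hf)
  tauto

lemma boundary_eq_between (hB : ∀ e ∈ B, p e ∈ V ∧ q e ∈ V) :
    boundary p q B X = between p q B X (V \ X) := by
  classical
  rw [boundary, filter_or, card_union_of_disjoint, between]
  · congr 2 <;> ext e <;> simp only [mem_filter, mem_links, mem_sdiff] <;> grind
  · exact disjoint_filter.2 fun e _ h h' => h'.1 h.1

lemma boundary_crossing (hQ : Q ⊆ P.parts) :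
    boundary p q (crossing p q P B) (Q.biUnion id) = boundary p q B (Q.biUnion id) := by
  have hblock : ∀ C ∈ P.parts, ∀ v ∈ C, ∀ w ∈ C, v ∈ Q.biUnion id → w ∈ Q.biUnion id := by
    simp only [mem_biUnion, id]
    rintro C hC v hvC w hwC ⟨D, hD, hvD⟩
    exact ⟨C, P.eq_of_mem_parts hC (hQ hD) hvC hvD ▸ hD, hwC⟩
  rw [boundary, boundary, crossing, filter_filter]
  congr 1
  refine filter_congr fun e _ => and_iff_right_of_imp fun he C hC hCe => ?_
  have := hblock C hC _ hCe.1 _ hCe.2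
  have := hblock C hC _ hCe.2 _ hCe.1
  tauto

lemma between_crossing (hB : ∀ e ∈ B, p e ∈ V ∧ q e ∈ V) (hQ : Q ⊆ P.parts) :
    between p q (crossing p q P B) (Q.biUnion id) V =
      2 * #(inside p q (crossing p q P B) (Q.biUnion id)) + boundary p q B (Q.biUnion id) := by
  have hQV : Q.biUnion id ⊆ V := biUnion_subset.2 fun C hC => P.subset (hQ hC)
  rw [← boundary_crossing hQ, boundary_eq_between fun e he => hB e (mem_crossing.1 he).1,
    ← between_self, ← between_union_right disjoint_sdiff, union_sdiff_of_subset hQV]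

lemma between_crossing_block (hB : ∀ e ∈ B, p e ∈ V ∧ q e ∈ V) {C : Finset α}
    (hC : C ∈ P.parts) : between p q (crossing p q P B) C V = boundary p q B C := by
  simpa [inside_crossing_block hC] using between_crossing hB (singleton_subset_iff.2 hC)

lemma IsTightPartition.exists_block_of_spans (hP : IsTightPartition p q k B P)
    (hk : 1 ≤ k) (hB : Sparse p q k B) (hV : ∀ e ∈ B, p e ∈ V ∧ q e ∈ V)
    (he : Spans p q k B e) (hp : p e ∈ V) : ∃ C ∈ P.parts, p e ∈ C ∧ q e ∈ C := by
  obtain ⟨T, hT, hpT, hqT⟩ := he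
  obtain ⟨C, hC, hTC⟩ := hP.exists_superset T hT (hT.subset_of_mem hk hB hV hpT hp)
  exact ⟨C, hC, hTC hpT, hTC hqT⟩

lemma crossing_congr (h : ∀ e, ¬ (e ∈ B ↔ e ∈ B') → ∃ C ∈ P.parts, p e ∈ C ∧ q e ∈ C) :
    crossing p q P B = crossing p q P B' := by
  ext e
  rw [mem_crossing, mem_crossing]
  refine and_congr_left fun hcross => ?_
  by_contra hne
  obtain ⟨C, hC, hCe⟩ := h e hne
  exact hcross C hC hCe

/-- The size condition on blocks passes to unions of blocks: `Q` blocks have at most `k * (#Q - 1)`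
edges between them, and joining blocks gains exactly what these edges contribute to boundaries. -/
lemma IsTightPartition.mul_one_sub_boundary_le {F : Finset β} {c : ℝ}
    (hP : IsTightPartition p q k B P) (hk : 1 ≤ k) (hB : Sparse p q k B)
    (hcross : crossing p q P F = crossing p q P B) (hF : ∀ e ∈ F, p e ∈ V ∧ q e ∈ V) (hc : 1 ≤ c)
    (hsize : ∀ C ∈ P.parts, c - (c - 1) / (2 * (k : ℝ)) * boundary p q F C ≤ #C)
    (hQ : Q ⊆ P.parts) (hQne : Q.Nonempty) :
    (c - 1) * (1 - (boundary p q F (Q.biUnion id) : ℝ) / (2 * k)) ≤ #(Q.biUnion id) - 1 := by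
  obtain ⟨C, hC⟩ := hQne
  have hdisj := pairwiseDisjoint_of_subset_parts hQ
  set X := Q.biUnion id
  set i := #(inside p q (crossing p q P F) X)
  have hk' : (0 : ℝ) < k := mod_cast hk
  have hi : (i : ℝ) / k ≤ #Q - 1 := by
    have hX : X.Nonempty := (P.nonempty_of_mem_parts (hQ hC)).mono (subset_biUnion_of_mem id hC)
    have hedges := hP.card_inside hQ
    have := hB X hX
    rw [← hcross] at hedges
    have : i + k ≤ k * #Q := by lia
    rw [div_le_iff₀ hk']
    have : (i : ℝ) + k ≤ k * #Q := mod_cast this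
    linarith
  have hboundary : ∑ C ∈ Q, (boundary p q F C : ℝ) = 2 * i + boundary p q F X := by
    rw [← Nat.cast_sum, ← sum_congr rfl fun C hC => between_crossing_block hF (hQ hC),
      sum_between hdisj, between_crossing hF hQ]
    push_cast
    rfl
  have hsum : c * #Q - (c - 1) / (2 * k) * (2 * i + boundary p q F X) ≤ #X := by
    have := sum_le_sum fun C (hC : C ∈ Q) => hsize C (hQ hC)
    rw [sum_sub_distrib, ← mul_sum, sum_const, nsmul_eq_mul, hboundary, ← Nat.cast_sum,
      mul_comm] at this
    rwa [card_biUnion hdisj]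
  have hQ1 : (1 : ℝ) ≤ #Q := mod_cast card_pos.2 ⟨C, hC⟩
  have hgain := mul_le_mul_of_nonneg_left hi (sub_nonneg.2 hc)
  have hexpand : (c - 1) / (2 * k) * (2 * i + boundary p q F X) =
      (c - 1) * (i / k) + (c - 1) * (boundary p q F X / (2 * k)) := by
    field_simp
  linarith

end Partitions

/-! ### Discharging -/

section Discharging

variable {α β : Type*} [DecidableEq α] {p q : β → α} {B : Finset β} {V W W' K Z : Finset α}
  {P : Finpartition V} {C : Finset α}

lemma exists_maximal_independent (p q : β → α) (B : Finset β) {K₀ : Finset α} (hK₀ : K₀ ⊆ W)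
    (hind : inside p q B K₀ = ∅) (hB : ∀ e ∈ B, p e ≠ q e) :
    ∃ K ⊆ W, K₀ ⊆ K ∧ inside p q B K = ∅ ∧
      ∀ v ∈ W, v ∉ K → ∃ e ∈ B, (p e = v ∧ q e ∈ K) ∨ (q e = v ∧ p e ∈ K) := by
  classical
  obtain ⟨K, hK₀K, hK⟩ := (W.powerset.filter fun K => inside p q B K = ∅).exists_le_maximal
    (mem_filter.2 ⟨mem_powerset.2 hK₀, hind⟩)
  obtain ⟨hKW, hKind⟩ := mem_filter.1 hK.prop
  rw [mem_powerset] at hKW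
  refine ⟨K, hKW, hK₀K, hKind, fun v hv hvK => ?_⟩
  have hinsert : (inside p q B (insert v K)).Nonempty := by
    by_contra hempty
    refine hvK (hK.le_of_ge (mem_filter.2 ⟨mem_powerset.2 (insert_subset hv hKW),
      not_nonempty_iff_eq_empty.1 hempty⟩) (subset_insert v K) (mem_insert_self v K))
  obtain ⟨e, he⟩ := hinsert
  obtain ⟨heB, hp, hq⟩ := mem_inside.1 he
  have hKe : ¬ (p e ∈ K ∧ q e ∈ K) := fun h => by
    simpa [hKind] using mem_inside.2 ⟨heB, h⟩
  rw [mem_insert] at hp hq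
  have := hB e heB
  refine ⟨e, heB, ?_⟩
  grind

lemma sum_card_inter_parts (hZ : Z ⊆ V) : ∑ C ∈ P.parts, #(C ∩ Z) = #Z := by
  rw [← (P.restrict hZ).sum_card_parts]
  exact (P.sum_restrict hZ card (by simp)).symm

/-- Discharging: a block that `K` misses is paid for by the edges that join the vertices of
`W \ K` to `K`, and these edges reduce the weights of the blocks that `K` meets. -/
lemma sum_le_of_dominating {φ : Finset α → ℝ} {t μ : ℝ} (hWV : W ⊆ V) (hKW : K ⊆ W)
    (htμ : t ≤ μ) (hμ : 0 ≤ μ)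
    (hdom : ∀ v ∈ W, v ∉ K → ∃ e ∈ B, (p e = v ∧ q e ∈ K) ∨ (q e = v ∧ p e ∈ K))
    (hkept : ∀ C ∈ P.parts, (C ∩ K).Nonempty → φ C ≤ 1 - between p q B C W * μ)
    (heaten : ∀ C ∈ P.parts, Disjoint C K → φ C ≤ (μ - t) * #(C ∩ W)) :
    ∑ C ∈ P.parts, φ C ≤ #{C ∈ P.parts | (C ∩ K).Nonempty} - t * (#W - #K) := by
  set kept := {C ∈ P.parts | (C ∩ K).Nonempty}
  have hkeptP : kept ⊆ P.parts := filter_subset _ _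
  have hsplit : ∀ C, (#(C ∩ W) : ℝ) = #(C ∩ K) + #(C ∩ (W \ K)) := fun C => by
    rw [← Nat.cast_add, ← card_union_of_disjoint, ← inter_union_distrib_left,
      union_sdiff_of_subset hKW]
    exact disjoint_sdiff.mono inter_subset_right inter_subset_right
  have hblock : ∀ C ∈ P.parts, φ C ≤ (if (C ∩ K).Nonempty then 1 - between p q B C W * μ else 0) +
      t * #(C ∩ K) + μ * #(C ∩ (W \ K)) - t * #(C ∩ W) := by
    intro C hC
    split_ifs with hCK
    · have := mul_le_mul_of_nonneg_right htμ (Nat.cast_nonneg #(C ∩ (W \ K)))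
      have := hkept C hC hCK
      rw [hsplit]
      linarith
    · rw [not_nonempty_iff_eq_empty, ← disjoint_iff_inter_eq_empty] at hCK
      have hle := heaten C hC hCK
      have hW := hsplit C
      rw [disjoint_iff_inter_eq_empty.1 hCK, card_empty, Nat.cast_zero, zero_add] at hW ⊢
      rw [← hW]
      linarith
  have hpaid : #(W \ K) ≤ between p q B (kept.biUnion id) W := by
    have hKkept : K ⊆ kept.biUnion id := fun v hv => by
      obtain ⟨C, hC, hvC⟩ := P.exists_mem (hWV (hKW hv))
      exact mem_biUnion.2 ⟨C, mem_filter.2 ⟨hC, v, mem_inter.2 ⟨hvC, hv⟩⟩, hvC⟩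
    rw [between_comm]
    exact (card_le_between fun v hv => hdom v (mem_sdiff.1 hv).1 (mem_sdiff.1 hv).2).trans
      (between_mono sdiff_subset hKkept)
  have hpaid' := mul_le_mul_of_nonneg_right (Nat.cast_le (α := ℝ).2 hpaid) hμ
  have hsum := sum_le_sum hblock
  rw [sum_sub_distrib, sum_add_distrib, sum_add_distrib, ← sum_filter, sum_sub_distrib, ← sum_mul,
    ← mul_sum, ← mul_sum, ← mul_sum, sum_const, nsmul_one, ← Nat.cast_sum, ← Nat.cast_sum,
    ← Nat.cast_sum, ← Nat.cast_sum, sum_between (pairwiseDisjoint_of_subset_parts hkeptP),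
    sum_card_inter_parts (hKW.trans hWV), sum_card_inter_parts (sdiff_subset.trans hWV),
    sum_card_inter_parts hWV] at hsum
  linarith

/-- The independent set is chosen greedily, first in `W ∩ W'` and then in `W`, so that the vertices
of `W ∩ W'` outside it already have neighbours in its part inside `W'`. -/
lemma sum_le_of_independent_bound {φ : Finset α → ℝ} {t μ n : ℝ} (hB : ∀ e ∈ B, p e ≠ q e)
    (hWV : W ⊆ V) (htμ : t ≤ μ) (hμ : 0 ≤ μ)
    (htough : ∀ K ⊆ W, inside p q B K = ∅ →
      (#{C ∈ P.parts | (C ∩ K).Nonempty} : ℝ) ≤ t * (n - #K) + 1)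
    (hkept : ∀ C ∈ P.parts, (C ∩ W).Nonempty → φ C ≤ 1 - between p q B C W * μ)
    (heaten : ∀ C ∈ P.parts, #(C ∩ W) ≤ between p q B C W →
      (C ⊆ W' → #(C ∩ W) ≤ between p q B C W') → φ C ≤ (μ - t) * #(C ∩ W)) :
    ∑ C ∈ P.parts, φ C ≤ t * (n - #W) + 1 := by
  obtain ⟨K₀, hK₀W, -, hK₀ind, hK₀dom⟩ := exists_maximal_independent p q B
    (empty_subset (W ∩ W')) (by simp [inside]) hB
  obtain ⟨K, hKW, hK₀K, hKind, hKdom⟩ := exists_maximal_independent p q B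
    (hK₀W.trans inter_subset_left) hK₀ind hB
  have hle := sum_le_of_dominating (P := P) hWV hKW htμ hμ hKdom
    (fun C hC hCK => hkept C hC (hCK.mono (inter_subset_inter_left hKW))) fun C hC hCK =>
      heaten C hC ?_ fun hCW' => ?_
  · linarith [htough K hKW hKind]
  · have hCW : #(C ∩ W) ≤ between p q B (C ∩ W) K := card_le_between fun v hv =>
      hKdom v (mem_inter.1 hv).2 (disjoint_left.1 hCK (mem_inter.1 hv).1)
    exact hCW.trans (between_mono inter_subset_left hKW)
  · have hCW : #(C ∩ W) ≤ between p q B (C ∩ W) K₀ := card_le_between fun v hv =>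
      hK₀dom v (mem_inter.2 ⟨(mem_inter.1 hv).2, hCW' (mem_inter.1 hv).1⟩)
        fun hvK => disjoint_left.1 hCK (mem_inter.1 hv).1 (hK₀K hvK)
    exact hCW.trans (between_mono inter_subset_left (hK₀W.trans inter_subset_right))

/-- The union of the blocks of `P` that are contained in `W`. -/
def core (P : Finpartition V) (W : Finset α) : Finset α := {C ∈ P.parts | C ⊆ W}.biUnion id

/-- The charge of a block: its weight `1 - between p q B C V * μ`, scaled by `c - 1`, to which a
block that is not contained in `W` adds its weight among the blocks of this kind minus its number of
vertices outside `W`. Each edge between a block inside `W` and a block disjoint from `W` moves `μ`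
from the latter to the former. -/
noncomputable def charge (p q : β → α) (B : Finset β) (P : Finpartition V) (W : Finset α) (c μ : ℝ)
    (C : Finset α) : ℝ :=
  (c - 1) * (1 - between p q B C V * μ) - #(C \ W) +
    (if C ⊆ W then between p q B C (core P (V \ W)) * μ
      else 1 - between p q B C (V \ core P W) * μ) -
    if C ⊆ V \ W then between p q B C (core P W) * μ else 0

lemma core_subset : core P W ⊆ W := biUnion_subset.2 fun _ hC => (mem_filter.1 hC).2

lemma core_subset_self : core P W ⊆ V :=
  biUnion_subset.2 fun _ hC => P.subset (mem_filter.1 hC).1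

lemma sdiff_core : V \ core P W = {C ∈ P.parts | ¬ C ⊆ W}.biUnion id := by
  ext v
  simp only [core, mem_sdiff, mem_biUnion, mem_filter, id, not_exists, not_and]
  constructor
  · rintro ⟨hvV, h⟩
    obtain ⟨C, hC, hvC⟩ := P.exists_mem hvV
    exact ⟨C, ⟨hC, fun hCW => h C ⟨hC, hCW⟩ hvC⟩, hvC⟩
  · rintro ⟨C, ⟨hC, hCW⟩, hvC⟩
    exact ⟨P.subset hC hvC, fun D hD hvD => hCW (P.eq_of_mem_parts hC hD.1 hvC hvD ▸ hD.2)⟩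

lemma subset_sdiff_core (hC : C ∈ P.parts) (hCW : ¬ C ⊆ W) : C ⊆ V \ core P W := by
  rw [sdiff_core]
  exact subset_biUnion_of_mem id (mem_filter.2 ⟨hC, hCW⟩)

lemma between_sdiff_add (hZ : Z ⊆ V) :
    between p q B C (V \ Z) + between p q B C Z = between p q B C V := by
  rw [← between_union_right sdiff_disjoint, sdiff_union_of_subset hZ]

lemma between_add_between_core_le (hWV : W ⊆ V) :
    between p q B C W + between p q B C (core P (V \ W)) ≤ between p q B C V := by
  rw [← between_union_right (disjoint_sdiff.mono_right core_subset)]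
  exact between_mono Subset.rfl (union_subset hWV core_subset_self)

variable {c μ : ℝ}

lemma charge_le_of_meets (hc : 2 ≤ c) (hμ : 0 ≤ μ) (hWV : W ⊆ V)
    (hCW : (C ∩ W).Nonempty) :
    charge p q B P W c μ C ≤ (c - 1) * (1 - between p q B C W * μ) := by
  obtain ⟨v, hv⟩ := hCW
  rw [mem_inter] at hv
  have hCS : ¬ C ⊆ V \ W := fun h => (mem_sdiff.1 (h hv.1)).2 hv.2
  have hsplit : (between p q B C W : ℝ) + between p q B C (core P (V \ W)) ≤ between p q B C V :=
    mod_cast between_add_between_core_le hWV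
  have : 0 ≤ between p q B C (core P (V \ W)) * μ := by positivity
  have hscaled := mul_le_mul_of_nonneg_left (mul_le_mul_of_nonneg_right hsplit hμ)
    (by linarith : 0 ≤ c - 1)
  rw [charge, if_neg hCS, sub_zero]
  split_ifs with hC
  · nlinarith [Nat.cast_nonneg (α := ℝ) #(C \ W)]
  · have houtside : (1 : ℝ) ≤ #(C \ W) := mod_cast card_pos.2 (sdiff_nonempty.2 hC)
    have : 0 ≤ between p q B C (V \ core P W) * μ := by positivity
    nlinarith

lemma charge_le_of_card_le (hc : 2 ≤ c) (hμ : 0 ≤ μ) (hWV : W ⊆ V) (hC : C ∈ P.parts)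
    (hsize : (c - 1) * (1 - between p q B C V * μ) ≤ #C - 1)
    (hW : #(C ∩ W) ≤ between p q B C W)
    (hcore : C ⊆ V \ core P W → #(C ∩ W) ≤ between p q B C (V \ core P W)) :
    charge p q B P W c μ C ≤ (1 - μ) * #(C ∩ W) := by
  have hcard : (#(C ∩ W) : ℝ) + #(C \ W) = #C := mod_cast card_inter_add_card_sdiff C W
  have hC1 : (1 : ℝ) ≤ #C := mod_cast (P.nonempty_of_mem_parts hC).card_pos
  rw [charge]
  split_ifs with hCW hCS hCS
  · exact absurd (P.nonempty_of_mem_parts hC) (by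
      rw [not_nonempty_iff_eq_empty, ← disjoint_self_iff_empty]
      exact disjoint_sdiff.mono hCW hCS)
  · have hsplit : (#(C ∩ W) : ℝ) + between p q B C (core P (V \ W)) ≤ between p q B C V :=
      mod_cast (Nat.add_le_add_right hW _).trans (between_add_between_core_le hWV)
    have hscaled := mul_le_mul_of_nonneg_right hsplit hμ
    have : (#(C \ W) : ℝ) = 0 := by simp [sdiff_eq_empty_iff_subset.2 hCW]
    rcases le_total 0 (1 - between p q B C V * μ) with h | h <;> nlinarith
  · have hsplit : (between p q B C (V \ core P W) : ℝ) + between p q B C (core P W) =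
        between p q B C V := mod_cast between_sdiff_add core_subset_self
    have hzero : (#(C ∩ W) : ℝ) = 0 := by
      simp [disjoint_iff_inter_eq_empty.1 (disjoint_sdiff.symm.mono_left hCS)]
    have : 0 ≤ between p q B C V * μ := by positivity
    have hsplitμ := congrArg (· * μ) hsplit
    simp only [add_mul] at hsplitμ
    rw [hzero]
    linarith
  · have := mul_le_mul_of_nonneg_right
      (Nat.cast_le (α := ℝ).2 (hcore (subset_sdiff_core hC hCW))) hμ
    linarith

lemma sum_charge : ∑ C ∈ P.parts, charge p q B P W c μ C =
    (c - 1) * ∑ C ∈ P.parts, (1 - between p q B C V * μ) +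
      ∑ C ∈ P.parts with ¬ C ⊆ W, (1 - between p q B C (V \ core P W) * μ) - #(V \ W) := by
  have houtside : ∑ C ∈ P.parts, (#(C \ W) : ℝ) = #(V \ W) := by
    rw [← sum_card_inter_parts (P := P) (sdiff_subset : V \ W ⊆ V), Nat.cast_sum]
    refine sum_congr rfl fun C hC => ?_
    rw [← inter_sdiff_assoc, inter_eq_left.2 (P.subset hC)]
  have htransfer : ∑ C ∈ P.parts with C ⊆ W, between p q B C (core P (V \ W)) * μ =
      ∑ C ∈ P.parts with C ⊆ V \ W, between p q B C (core P W) * μ := by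
    rw [← sum_mul, ← sum_mul, ← Nat.cast_sum, ← Nat.cast_sum,
      sum_between (pairwiseDisjoint_of_subset_parts (filter_subset _ _)),
      sum_between (pairwiseDisjoint_of_subset_parts (filter_subset _ _)), between_comm]
    rfl
  simp only [charge]
  rw [sum_sub_distrib, sum_add_distrib, sum_sub_distrib, ← mul_sum, houtside, sum_ite,
    htransfer, ← sum_filter]
  ring

lemma sum_one_sub_between_le {t : ℝ} (hc : 2 ≤ c) (hμ : 0 ≤ μ) (hμ1 : μ ≤ 1)
    (ht : (c - 1) * t = c * μ - 1) (hB : ∀ e ∈ B, p e ≠ q e) (hWV : W ⊆ V)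
    (hsize : ∀ C ∈ P.parts, (c - 1) * (1 - between p q B C V * μ) ≤ #C - 1)
    (htough : ∀ K ⊆ W, inside p q B K = ∅ →
      (#{C ∈ P.parts | (C ∩ K).Nonempty} : ℝ) ≤ t * (#V - #K) + 1) :
    (c - 1) * ∑ C ∈ P.parts, (1 - between p q B C V * μ) +
      ∑ C ∈ P.parts with ¬ C ⊆ W, (1 - between p q B C (V \ core P W) * μ) ≤
        c * μ * #(V \ W) + (c - 1) := by
  have hc1 : 0 < c - 1 := by linarith
  have hgap : (c - 1) * (μ - t) = 1 - μ := by rw [mul_sub, ht]; ring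
  have hle : ∑ C ∈ P.parts, charge p q B P W c μ C / (c - 1) ≤ t * (#V - #W) + 1 := by
    refine sum_le_of_independent_bound (W' := V \ core P W) hB hWV ?_ hμ htough ?_ ?_
    · nlinarith
    · intro C _ hCW
      rw [div_le_iff₀' hc1]
      exact charge_le_of_meets hc hμ hWV hCW
    · intro C hC hCW hcore
      rw [div_le_iff₀' hc1, ← mul_assoc, hgap]
      exact charge_le_of_card_le hc hμ hWV hC (hsize C hC) hCW hcore
  have hcard : (#(V \ W) : ℝ) = #V - #W := by rw [cast_card_sdiff hWV]
  rw [← sum_div, div_le_iff₀' hc1, sum_charge, mul_add, ← mul_assoc, ht, ← hcard] at hle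
  linarith

lemma mul_card_parts_sub_card_add_le {m : ℕ} (hm : 1 ≤ m) (hc : 2 ≤ c)
    (hB : ∀ e ∈ B, p e ≠ q e) (hBV : ∀ e ∈ B, p e ∈ V ∧ q e ∈ V) (hWV : W ⊆ V)
    (hsize : ∀ C ∈ P.parts, (c - 1) * (1 - (between p q B C V : ℝ) / (2 * m)) ≤ #C - 1)
    (htough : ∀ K ⊆ W, inside p q B K = ∅ → (#{C ∈ P.parts | (C ∩ K).Nonempty} : ℝ) ≤
      (c - 2 * m) / (2 * m * (c - 1)) * (#V - #K) + 1) :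
    (c - 1) * (m * #P.parts - #B) +
      (m * #{C ∈ P.parts | ¬ C ⊆ W} - #(inside p q B (V \ core P W))) ≤
        c / 2 * #(V \ W) + m * (c - 1) := by
  have hm' : (1 : ℝ) ≤ m := mod_cast hm
  have hc1 : c - 1 ≠ 0 := by linarith
  have hQ : {C ∈ P.parts | ¬ C ⊆ W} ⊆ P.parts := filter_subset _ _
  have hle := sum_one_sub_between_le (μ := (2 * m : ℝ)⁻¹) hc (by positivity)
    (inv_le_one_of_one_le₀ (by linarith)) (by field_simp) hB hWV
    (by simpa only [div_eq_mul_inv] using hsize) htough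
  simp only [sum_sub_distrib, ← sum_mul, ← Nat.cast_sum, sum_const, nsmul_one] at hle
  rw [sum_between P.disjoint, P.biUnion_parts, sum_between (pairwiseDisjoint_of_subset_parts hQ),
    ← sdiff_core, between_self, between_self, inside_eq_self hBV] at hle
  push_cast at hle
  have hscaled := mul_le_mul_of_nonneg_left hle (by positivity : (0 : ℝ) ≤ m)
  have hhalf : (m : ℝ) * (2 * m : ℝ)⁻¹ = 1 / 2 := by field_simp
  linear_combination hscaled + (c * #(V \ W) + 2 * (c - 1) * #B +
    2 * #(inside p q B (V \ core P W))) * hhalf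

end Discharging

/-! ### Completion by a matching -/

section Completion

variable {α β : Type*} [DecidableEq α] {p q : β → α} {k m : ℕ} {A B F N M : Finset β}
  {V W S K C : Finset α} {P P₀ : Finpartition V} {u : α}

lemma Feasible.two_mul_card_inside_le [DecidableEq β] (hM : Feasible p q m B N u M) :
    2 * #(inside p q M S) ≤ #(S.erase u) := by
  have hp : Set.InjOn p (inside p q M S : Set β) := fun e he f hf h =>
    hM.eq_of_inc e (inside_subset he) f (inside_subset hf) (p f) (.inl h) (.inl rfl)
  have hq : Set.InjOn q (inside p q M S : Set β) := fun e he f hf h =>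
    hM.eq_of_inc e (inside_subset he) f (inside_subset hf) (q f) (.inr h) (.inr rfl)
  have hdisj : Disjoint ((inside p q M S).image p) ((inside p q M S).image q) := by
    rw [disjoint_left]
    intro v hv hv'
    obtain ⟨e, he, rfl⟩ := mem_image.1 hv
    obtain ⟨f, hf, hfe⟩ := mem_image.1 hv'
    obtain rfl := hM.eq_of_inc e (inside_subset he) f (inside_subset hf) (p e) (.inl rfl) (.inr hfe)
    exact hM.sparse.ne (mem_union_right _ (inside_subset he)) hfe.symm
  have hsub : (inside p q M S).image p ∪ (inside p q M S).image q ⊆ S.erase u := by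
    refine union_subset (image_subset_iff.2 fun e he => ?_) (image_subset_iff.2 fun e he => ?_)
    · exact mem_erase.2 ⟨fun h => hM.misses e (inside_subset he) (.inl h), (mem_inside.1 he).2.1⟩
    · exact mem_erase.2 ⟨fun h => hM.misses e (inside_subset he) (.inr h), (mem_inside.1 he).2.2⟩
  have hcard := card_le_card hsub
  rw [card_union_of_disjoint hdisj, card_image_of_injOn hp, card_image_of_injOn hq] at hcard
  lia

lemma card_erase_add_card_inside_le (hMV : ∀ e ∈ M, p e ∈ V ∧ q e ∈ V) (hWV : W ⊆ V)
    (hcov : ∀ v ∈ V \ W, v ≠ u → ¬ Misses p q M v) :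
    #(inside p q M W) + #((V \ W).erase u) ≤ #M + #(inside p q M (V \ W)) := by
  have hcovered : #((V \ W).erase u) ≤ between p q M (V \ W) V := by
    refine (card_le_between fun v hv => ?_).trans (between_mono (erase_subset u _) Subset.rfl)
    obtain ⟨hvu, hv⟩ := mem_erase.1 hv
    have := hcov v hv hvu
    simp only [Misses, not_forall, not_not] at this
    obtain ⟨e, he, hev | hev⟩ := this
    exacts [⟨e, he, .inl ⟨hev, (hMV e he).2⟩⟩, ⟨e, he, .inr ⟨hev, (hMV e he).1⟩⟩]
  have hsplit : ∀ Y, between p q M Y V = between p q M Y (V \ W) + between p q M Y W := fun Y => by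
    rw [← between_union_right sdiff_disjoint, sdiff_union_of_subset hWV]
  have hM : between p q M (V \ W) V + between p q M W V = 2 * #M := by
    rw [← between_union_left sdiff_disjoint, sdiff_union_of_subset hWV, between_self,
      inside_eq_self hMV]
  have hW := hsplit W
  have hU := hsplit (V \ W)
  rw [between_self] at hW hU
  rw [between_comm (X := W) (Y := V \ W)] at hW
  lia

lemma Feasible.card_crossing_add_le [DecidableEq β] (hM : Feasible p q m B N u M)
    (hBN : Disjoint B N) (hP : IsTightPartition p q m (B ∪ inside p q M W) P) (hu : u ∈ V \ W) :
    #(inside p q (crossing p q P (B ∪ inside p q M W)) (V \ core P W)) + m +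
      #(inside p q M (V \ W)) ≤ m * #{C ∈ P.parts | ¬ C ⊆ W} := by
  have hSU : V \ W ⊆ V \ core P W := sdiff_subset_sdiff Subset.rfl core_subset
  have hedges := hP.card_inside (filter_subset (fun C => ¬ C ⊆ W) P.parts)
  rw [← sdiff_core] at hedges
  have hsparse := hM.sparse (V \ core P W) ⟨u, hSU hu⟩
  have hdisj : Disjoint (inside p q (B ∪ inside p q M W) (V \ core P W))
      (inside p q M (V \ W)) := by
    refine disjoint_left.2 fun e he he' => ?_
    obtain ⟨heM, hpe, -⟩ := mem_inside.1 he'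
    rcases mem_union.1 (inside_subset he) with heB | heW
    · exact disjoint_left.1 hBN heB (hM.subset heM)
    · exact (mem_sdiff.1 hpe).2 (mem_inside.1 heW).2.1
  have hsub := card_le_card (union_subset
    (inside_mono (union_subset_union_right inside_subset) Subset.rfl)
    (inside_mono (subset_union_right (s₁ := B)) hSU) :
    inside p q (B ∪ inside p q M W) (V \ core P W) ∪ inside p q M (V \ W) ⊆
      inside p q (B ∪ M) (V \ core P W))
  rw [card_union_of_disjoint hdisj] at hsub
  lia

/-- If `B ∪ M` were too small, the vertices outside `W`, all but `u` of which `M` covers, would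
force too few edges between the blocks of `P`. -/
lemma Feasible.mul_card_le [DecidableEq β] {c : ℝ} (hm : 1 ≤ m) (hc : 2 ≤ c)
    (hM : Feasible p q m B N u M)
    (hBN : Disjoint B N) (hBV : ∀ e ∈ B, p e ∈ V ∧ q e ∈ V) (hN : ∀ e ∈ N, p e ∈ V ∧ q e ∈ V)
    (hW : Freeable p q m B N u V M W) (hu : u ∈ V)
    (hP : IsTightPartition p q m (B ∪ inside p q M W) P)
    (hweight : (c - 1) * (m * #P.parts - #(crossing p q P (B ∪ inside p q M W))) +
      (m * #{C ∈ P.parts | ¬ C ⊆ W} -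
        #(inside p q (crossing p q P (B ∪ inside p q M W)) (V \ core P W))) ≤
        c / 2 * #(V \ W) + m * (c - 1)) :
    m * #V ≤ #(B ∪ M) + m := by
  have huS : u ∈ V \ W := mem_sdiff.2 ⟨hu, hW.notMem⟩
  have hAV : ∀ e ∈ B ∪ inside p q M W, p e ∈ V ∧ q e ∈ V := fun e he =>
    (mem_union.1 he).elim (hBV e) fun he => hN e (hM.subset (inside_subset he))
  have hedges : #B + #(inside p q M W) + m * #P.parts =
      m * #V + #(crossing p q P (B ∪ inside p q M W)) := by
    have h := hP.card_inside Subset.rfl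
    rwa [P.biUnion_parts, inside_eq_self hAV,
      inside_eq_self fun e he => hAV e (mem_crossing.1 he).1,
      card_union_of_disjoint (hBN.mono_right (inside_subset.trans hM.subset))] at h
  have hcover := card_erase_add_card_inside_le (u := u) (fun e he => hN e (hM.subset he)) hW.subset
    fun v hv hvu hmiss => (mem_sdiff.1 hv).2 (hW.mem_of_misses v (mem_sdiff.1 hv).1 hvu hmiss)
  have hmatching := hM.two_mul_card_inside_le (S := V \ W)
  have houter := hM.card_crossing_add_le hBN hP huS
  have herase := card_erase_add_one huS
  rw [card_union_of_disjoint (hBN.mono_right hM.subset)]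
  by_contra hlt
  have hsmall : #B + #M + m + 1 ≤ m * #V := by lia
  rify at hedges hcover hmatching houter herase hsmall hm
  have hblocks : (m : ℝ) + 1 + #((V \ W).erase u) - #(inside p q M (V \ W)) ≤
      m * #P.parts - #(crossing p q P (B ∪ inside p q M W)) := by linarith
  have hscaled := mul_le_mul_of_nonneg_left hblocks (by linarith : 0 ≤ c - 1)
  have hscaled' := mul_le_mul_of_nonneg_left hmatching (by linarith : 0 ≤ (c - 2) / 2)
  rw [← herase] at hweight
  linarith

lemma IsTightPartition.exists_biUnion_eq (hP₀ : IsTightPartition p q k B P₀)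
    (hP : IsTightPartition p q k A P) (hBA : B ⊆ A) (hA : Sparse p q k A) (hC : C ∈ P.parts) :
    ∃ Q ⊆ P₀.parts, Q.Nonempty ∧ Q.biUnion id = C := by
  obtain ⟨v₀, hv₀⟩ := P.nonempty_of_mem_parts hC
  have hpart : ∀ v ∈ C, P₀.part v ∈ P₀.parts ∧ P₀.part v ⊆ C ∧ v ∈ P₀.part v := by
    intro v hv
    have hvV : v ∈ V := P.subset hC hv
    have hD : P₀.part v ∈ P₀.parts := P₀.part_mem.2 hvV
    obtain ⟨C', hC', hDC'⟩ := hP.exists_superset _ ((hP₀.tight _ hD).mono hBA hA) (P₀.subset hD)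
    have hv' : v ∈ P₀.part v := P₀.mem_part hvV
    exact ⟨hD, P.eq_of_mem_parts hC' hC (hDC' hv') hv ▸ hDC', hv'⟩
  refine ⟨{D ∈ P₀.parts | D ⊆ C}, filter_subset _ _, ⟨P₀.part v₀, mem_filter.2 ?_⟩, ?_⟩
  · exact ⟨(hpart v₀ hv₀).1, (hpart v₀ hv₀).2.1⟩
  · refine Subset.antisymm (biUnion_subset.2 fun D hD => (mem_filter.1 hD).2) fun v hv => ?_
    obtain ⟨hD, hDC, hvD⟩ := hpart v hv
    exact mem_biUnion.2 ⟨_, mem_filter.2 ⟨hD, hDC⟩, hvD⟩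

lemma card_meets_le_card_image_part : #{C ∈ P.parts | (C ∩ K).Nonempty} ≤ #(K.image P.part) := by
  refine card_le_card fun C hC => ?_
  obtain ⟨hC, v, hv⟩ := mem_filter.1 hC
  rw [mem_inter] at hv
  exact mem_image.2 ⟨v, hv.2, P.part_eq_of_mem hC hv.1⟩

lemma IsTightPartition.mul_one_sub_boundary_le_of_subset {c : ℝ}
    (hP : IsTightPartition p q k A P) (hk : 1 ≤ k) (hc : 1 ≤ c) (hA : Sparse p q k A)
    (hBA : B ⊆ A) (hBF : B ⊆ F) (hF : ∀ e ∈ F, p e ∈ V ∧ q e ∈ V)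
    (hspan : ∀ e ∈ F, e ∉ B → Spans p q k B e)
    (hsize : ∀ C, Maximal (fun T => Tight p q k B T ∧ T ⊆ V) C →
      c - (c - 1) / (2 * (k : ℝ)) * boundary p q F C ≤ #C) (hC : C ∈ P.parts) :
    (c - 1) * (1 - (boundary p q F C : ℝ) / (2 * k)) ≤ #C - 1 := by
  have hB : Sparse p q k B := hA.mono hBA
  obtain ⟨P₀, hP₀⟩ := exists_isTightPartition hB V
  have hcross : crossing p q P₀ F = crossing p q P₀ B := crossing_congr fun e he => by
    have heF : e ∈ F ∧ e ∉ B := by have := @hBF e; tauto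
    exact hP₀.exists_block_of_spans hk hB (fun e he => hF e (hBF he)) (hspan e heF.1 heF.2)
      (hF e heF.1).1
  obtain ⟨Q, hQ, hQne, rfl⟩ := hP₀.exists_biUnion_eq hP hBA hA hC
  exact hP₀.mul_one_sub_boundary_le hk hB hcross hF hc (fun D hD => hsize D (hP₀.maximal hD)) hQ
    hQne

lemma part_eq_part_of_inside_crossing [DecidableEq β] (hK : inside p q (crossing p q P F) K = ∅)
    (hN : ∀ e ∈ N, p e ∈ K → q e ∈ K → ∃ C ∈ P.parts, p e ∈ C ∧ q e ∈ C) {e : β}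
    (he : e ∈ F ∪ N) (hp : p e ∈ K) (hq : q e ∈ K) : P.part (p e) = P.part (q e) := by
  obtain ⟨C, hC, hpC, hqC⟩ : ∃ C ∈ P.parts, p e ∈ C ∧ q e ∈ C := by
    rcases mem_union.1 he with heF | heN
    · by_contra! hne
      have hmem : e ∈ inside p q (crossing p q P F) K :=
        mem_inside.2 ⟨mem_crossing.2 ⟨heF, fun C hC h => hne C hC h.1 h.2⟩, hp, hq⟩
      simp [hK] at hmem
    · exact hN e heN hp hq
  rw [P.part_eq_of_mem hC hpC, P.part_eq_of_mem hC hqC]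

lemma exists_feasible_max [DecidableEq β] (hB : Sparse p q m B) :
    ∃ M, Feasible p q m B N u M ∧ ∀ M', Feasible p q m B N u M' → #M' ≤ #M := by
  classical
  have hempty : Feasible p q m B N u ∅ :=
    ⟨empty_subset N, by simp, by simp [Misses], by rwa [union_empty]⟩
  obtain ⟨M, hM, hmax⟩ := exists_max_image {M ∈ N.powerset | Feasible p q m B N u M} card
    ⟨∅, mem_filter.2 ⟨empty_mem_powerset N, hempty⟩⟩
  exact ⟨M, (mem_filter.1 hM).2, fun M' hM' =>
    hmax M' (mem_filter.2 ⟨mem_powerset.2 hM'.subset, hM'⟩)⟩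

theorem exists_feasible_card_eq [DecidableEq β] {c : ℝ} (hm : 1 ≤ m) (hc : 2 ≤ c)
    (hF : ∀ e ∈ F, p e ∈ V ∧ q e ∈ V) (hN : ∀ e ∈ N, p e ∈ V ∧ q e ∈ V) (hFN : Disjoint F N)
    (hB : Sparse p q m B) (hBF : B ⊆ F) (hspan : ∀ e ∈ F, e ∉ B → Spans p q m B e)
    (hsize : ∀ C, Maximal (fun T => Tight p q m B T ∧ T ⊆ V) C →
      c - (c - 1) / (2 * (m : ℝ)) * boundary p q F C ≤ #C)
    (htough : ∀ K ⊆ V, ∀ r : α → Finset α,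
      (∀ e ∈ F ∪ N, p e ∈ K → q e ∈ K → r (p e) = r (q e)) →
      (#(K.image r) : ℝ) ≤ (c - 2 * m) / (2 * m * (c - 1)) * #(V \ K) + 1)
    (hu : u ∈ V) :
    ∃ M, Feasible p q m B N u M ∧ #(B ∪ M) + m = m * #V := by
  have hBN : Disjoint B N := hFN.mono_left hBF
  have hBV : ∀ e ∈ B, p e ∈ V ∧ q e ∈ V := fun e he => hF e (hBF he)
  obtain ⟨M, hM, hmax⟩ := exists_feasible_max (N := N) (u := u) hB
  obtain ⟨W, hW, hWN⟩ := hM.exists_freeable hBN hN hmax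
  set A := B ∪ inside p q M W
  have hBA : B ⊆ A := subset_union_left
  have hA : Sparse p q m A := hM.sparse.mono (union_subset_union_right inside_subset)
  have hAV : ∀ e ∈ A, p e ∈ V ∧ q e ∈ V := fun e he =>
    (mem_union.1 he).elim (hBV e) fun he => hN e (hM.subset (inside_subset he))
  obtain ⟨P, hP⟩ := exists_isTightPartition hA V
  have hblockF : ∀ e ∈ F, e ∉ A → ∃ C ∈ P.parts, p e ∈ C ∧ q e ∈ C := fun e he heA =>
    hP.exists_block_of_spans hm hA hAV ((hspan e he fun heB => heA (hBA heB)).mono hBA hA)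
      (hF e he).1
  have hblockN : ∀ e ∈ N, p e ∈ W → q e ∈ W → ∃ C ∈ P.parts, p e ∈ C ∧ q e ∈ C :=
    fun e he hpe hqe => hP.exists_block_of_spans hm hA hAV (hWN e he hpe hqe) (hN e he).1
  have hcross : crossing p q P F = crossing p q P A := crossing_congr fun e he => by
    by_cases heF : e ∈ F
    · exact hblockF e heF fun heA => he (iff_of_true heF heA)
    · have heA : e ∈ A := by tauto
      obtain ⟨heM, hpe, hqe⟩ := mem_inside.1 ((mem_union.1 heA).resolve_left fun h => heF (hBF h))
      exact hblockN e (hM.subset heM) hpe hqe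
  have hweight := mul_card_parts_sub_card_add_le (P := P) hm hc
    (fun e he => hA.ne (mem_crossing.1 he).1) (fun e he => hAV e (mem_crossing.1 he).1) hW.subset
    (fun C hC => by
      rw [← hcross, between_crossing_block hF hC]
      exact hP.mul_one_sub_boundary_le_of_subset hm (by linarith) hA hBA hBF hF hspan hsize hC)
    (fun K hKW hK => by
      rw [← cast_card_sdiff (hKW.trans hW.subset)]
      refine (Nat.cast_le.2 card_meets_le_card_image_part).trans
        (htough K (hKW.trans hW.subset) P.part fun e he hpe hqe => ?_)
      exact part_eq_part_of_inside_crossing (hcross ▸ hK)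
        (fun e he hpe hqe => hblockN e he (hKW hpe) (hKW hqe)) he hpe hqe)
  have hle := hM.sparse V ⟨u, hu⟩
  rw [inside_eq_self fun e he => (mem_union.1 he).elim (hBV e) fun he => hN e (hM.subset he)] at hle
  exact ⟨M, hM, hle.antisymm (hM.mul_card_le hm hc hBN hBV hN hW hu hP hweight)⟩

end Completion

/-! ### Sparse sets in graphs -/

section Trees

variable {α β ι : Type*} {p q : β → α} {k m : ℕ} {F G H T : Graph α β} {B D E : Finset β}
  {X Y V K : Finset α} {e : β} {v w : α}

/-- `p` and `q` name the two ends of every edge of `G`. -/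
def IsEnds (G : Graph α β) (p q : β → α) : Prop := ∀ e ∈ E(G), G.IsLink e (p e) (q e)

lemma exists_isEnds [Nonempty α] (G : Graph α β) : ∃ p q : β → α, IsEnds G p q := by
  have hlink : ∀ e, ∃ x y, e ∈ E(G) → G.IsLink e x y := fun e => by
    by_cases he : e ∈ E(G)
    · obtain ⟨x, y, hxy⟩ := Graph.exists_isLink_of_mem_edgeSet he
      exact ⟨x, y, fun _ => hxy⟩
    · exact ⟨Classical.arbitrary α, Classical.arbitrary α, fun h => absurd h he⟩
  choose p q hpq using hlink
  exact ⟨p, q, hpq⟩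

lemma IsEnds.mono (hG : IsEnds G p q) (hHG : H ≤ G) : IsEnds H p q := fun e he =>
  (hHG.isLink_iff he).2 (hG e (hHG.edgeSet_mono he))

lemma IsEnds.isLink_iff (hG : IsEnds G p q) (he : e ∈ E(G)) :
    G.IsLink e v w ↔ (p e = v ∧ q e = w) ∨ (p e = w ∧ q e = v) :=
  (hG e he).isLink_iff

lemma IsEnds.inc_iff (hG : IsEnds G p q) (he : e ∈ E(G)) : G.Inc e v ↔ Inc p q e v := by
  simp only [Graph.Inc, hG.isLink_iff he, Inc]
  grind

lemma IsEnds.mem_vertexSet (hG : IsEnds G p q) (hVG : V(G) = (V : Set α)) (he : e ∈ E(G)) :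
    p e ∈ V ∧ q e ∈ V := by
  rw [← mem_coe, ← mem_coe, ← hVG]
  exact ⟨(hG e he).left_mem, (hG e he).right_mem⟩

lemma IsEnds.mem_edgeSet_induce_iff (hG : IsEnds G p q) (he : e ∈ E(G)) :
    e ∈ E(G.induce (X : Set α)) ↔ p e ∈ X ∧ q e ∈ X := by
  rw [Graph.edgeSet_induce]
  simp only [Set.mem_ofPred_eq, hG.isLink_iff he, mem_coe]
  grind

lemma card_edgeSet_le {γ : Type*} {Γ : SimpleGraph γ} {φ : γ → α} (hφ : φ.Injective)
    (hΓ : ∀ a b, Γ.Adj a b → ∃ e ∈ D, s(p e, q e) = s(φ a, φ b)) :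
    Nat.card Γ.edgeSet ≤ #D := by
  classical
  have hsub : Sym2.map φ '' Γ.edgeSet ⊆ (D.image fun e => s(p e, q e) : Finset (Sym2 α)) := by
    rintro _ ⟨s, hs, rfl⟩
    induction s using Sym2.ind with
    | _ a b => simpa using hΓ a b hs
  rw [Nat.card_coe_set_eq, ← Set.ncard_image_of_injective _ (Sym2.map.injective hφ)]
  refine (Set.ncard_le_ncard hsub (finite_toSet _)).trans ?_
  rw [Set.ncard_coe_finset]
  exact card_image_le

variable [DecidableEq α]

lemma Sparse.simple (hD : Sparse p q 1 D) (hT : IsEnds T p q) (hTD : E(T) ⊆ D) : T.Simple := by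
  refine { not_isLoopAt := fun e x he => ?_, eq_of_isLink := fun e f x y he hf => ?_ }
  · have hloop := (hT.isLink_iff he.edge_mem).1 he
    exact hD.ne (hTD he.edge_mem) (by grind)
  · classical
    by_contra hne
    have hin : ∀ {g}, T.IsLink g x y → g ∈ inside p q D {x, y} := fun {g} hg => by
      rw [mem_inside]
      refine ⟨hTD hg.edge_mem, ?_⟩
      rcases (hT.isLink_iff hg.edge_mem).1 hg with ⟨rfl, rfl⟩ | ⟨rfl, rfl⟩ <;> simp
    have htwo : ({e, f} : Finset β) ⊆ inside p q D {x, y} := by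
      rw [insert_subset_iff, singleton_subset_iff]
      exact ⟨hin he, hin hf⟩
    have hcard := card_le_card htwo
    have hsparse := hD {x, y} ⟨x, by simp⟩
    have : #({x, y} : Finset α) ≤ 2 := card_le_two
    rw [card_pair hne] at hcard
    lia

lemma Tight.connected (hX : Tight p q k D X) (hk : 1 ≤ k) (hD : Sparse p q k D)
    (hT : IsEnds T p q) (hVT : V(T) = (X : Set α)) (hET : E(T) = inside p q D X) :
    T.toSimpleGraph.Connected := by
  classical
  have hmem : ∀ {v}, v ∈ X ↔ v ∈ V(T) := by simp [hVT]
  obtain ⟨x₀, hx₀⟩ := hX.1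
  have : Nonempty V(T) := ⟨⟨x₀, hmem.1 hx₀⟩⟩
  refine ⟨fun x y => ?_⟩
  set R := X.filter fun v => ∃ hv : v ∈ V(T), T.toSimpleGraph.Reachable x ⟨v, hv⟩
  have hstep : ∀ {v w e}, T.IsLink e v w → v ∈ R → w ∈ R := fun {v w e} he hvR => by
    obtain ⟨-, hv, hreach⟩ := mem_filter.1 hvR
    refine mem_filter.2 ⟨hmem.2 he.right_mem, he.right_mem, ?_⟩
    by_cases hvw : v = w
    · subst hvw
      exact hreach
    · exact hreach.trans
        (SimpleGraph.Adj.reachable ⟨fun h => hvw (congrArg Subtype.val h), e, he⟩)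
  have hXR : X ⊆ R := by
    by_contra hnot
    have hxR : (x : α) ∈ X ∩ R := by
      simp only [mem_inter, R, mem_filter, hmem]
      exact ⟨x.2, x.2, x.2, .refl _⟩
    obtain ⟨e, he, hcross⟩ := hX.exists_crossing hk hD ⟨x, hxR⟩ hnot
    have hlink := hT e (hET ▸ he)
    have := hstep hlink
    have := hstep hlink.symm
    tauto
  exact (mem_filter.1 (hXR (hmem.2 y.2))).2.2

lemma Tight.isTree (hX : Tight p q 1 D X) (hD : Sparse p q 1 D)
    (hT : IsEnds T p q) (hVT : V(T) = (X : Set α)) (hET : E(T) = inside p q D X) : T.IsTree := by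
  have : Finite V(T) := hVT ▸ X.finite_toSet
  have hconn := hX.connected le_rfl hD hT hVT hET
  refine ⟨hD.simple hT (hET.trans_subset (mod_cast inside_subset)), ?_⟩
  refine SimpleGraph.isTree_iff_connected_and_card.2
    ⟨hconn, le_antisymm ?_ hconn.card_vert_le_card_edgeSet_add_one⟩
  have hcard : Nat.card V(T) = #(inside p q D X) + 1 := by
    rw [hX.2, one_mul, Nat.card_coe_set_eq, hVT, Set.ncard_coe_finset]
  rw [hcard]
  refine Nat.add_le_add_right (card_edgeSet_le Subtype.val_injective (p := p) (q := q) ?_) 1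
  rintro a b ⟨-, e, he⟩
  refine ⟨e, mem_coe.1 (hET ▸ he.edge_mem), ?_⟩
  rw [Sym2.eq_iff]
  exact (hT.isLink_iff he.edge_mem).1 he

lemma Tight.isTreeConnected (hX : Tight p q m B X) (hB : Sparse p q m B)
    (hG : IsEnds G p q) (hBG : ∀ e ∈ B, e ∈ E(G)) (hXG : (X : Set α) ⊆ V(G)) :
    (G.induce (X : Set α)).IsTreeConnected m := by
  obtain ⟨T, hT⟩ := Sparse.exists_isSparseDecomposition (k := fun _ : Fin m => 1)
    (fun _ => le_rfl) (by simpa using hB)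
  have htight : ∀ i, Tight p q 1 (T i) X := by
    have hle : ∀ i ∈ univ, #(inside p q (T i) X) + 1 ≤ #X := fun i _ => by
      simpa using hT.sparse i X hX.1
    have hsum : ∑ i, (#(inside p q (T i) X) + 1) = ∑ _i : Fin m, #X := by
      rw [sum_add_distrib, ← hT.card_inside]
      simpa using hX.2
    exact fun i => ⟨hX.1, by simpa using (sum_eq_sum_iff_of_le hle).1 hsum i (mem_univ i)⟩
  refine ⟨fun i => (G.induce (X : Set α)).restrict (T i : Set β), fun i =>
    ⟨⟨Graph.restrict_le, rfl⟩, ?_⟩, fun i j hij => ?_⟩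
  · have hends := hG.mono ((Graph.restrict_le (E₀ := (T i : Set β))).trans (Graph.induce_le hXG))
    refine (htight i).isTree (hT.sparse i) hends rfl ?_
    ext e
    rw [Graph.edgeSet_restrict, Set.mem_inter_iff, and_comm, mem_coe, mem_coe, mem_inside]
    exact and_congr_right fun he => hG.mem_edgeSet_induce_iff (hBG e (hT.subset i he))
  · exact (disjoint_coe.2 (hT.disjoint hij)).mono Set.inter_subset_right Set.inter_subset_right

omit [DecidableEq α] in
lemma card_image_le_of_connected [DecidableEq ι] (hT : T.toSimpleGraph.Connected)
    (hVT : V(T) = (Y : Set α)) (hends : IsEnds T p q) (r : α → ι)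
    (hD : ∀ e ∈ E(T), r (p e) ≠ r (q e) → e ∈ D) : #(Y.image r) ≤ #D + 1 := by
  let f : V(T) → {a // a ∈ Y.image r} := fun v =>
    ⟨r v, mem_image_of_mem r (mem_coe.1 (hVT.subset v.2))⟩
  let Γ : SimpleGraph {a // a ∈ Y.image r} :=
    .fromRel fun a b => ∃ e ∈ D, s(r (p e), r (q e)) = s(a.1, b.1)
  have hstep : ∀ x y : V(T), T.toSimpleGraph.Adj x y →
      Relation.ReflTransGen Γ.Adj (f x) (f y) := by
    rintro x y ⟨-, e, he⟩
    by_cases hxy : f x = f y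
    · rw [hxy]
    have hr : s(r (p e), r (q e)) = s(r x, r y) := by
      rcases (hends.isLink_iff he.edge_mem).1 he with ⟨hp, hq⟩ | ⟨hp, hq⟩
      exacts [by rw [hp, hq], by rw [hp, hq, Sym2.eq_swap]]
    refine .single ((SimpleGraph.fromRel_adj _ _ _).2 ⟨hxy, .inl ⟨e, ?_, hr⟩⟩)
    refine hD e he.edge_mem fun h => hxy (Subtype.ext ?_)
    rw [h, Sym2.eq_iff] at hr
    exact hr.elim (fun h' => h'.1.symm.trans h'.2) fun h' => h'.2.symm.trans h'.1
  have hsurj : f.Surjective := by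
    rintro ⟨a, ha⟩
    obtain ⟨v, hv, rfl⟩ := mem_image.1 ha
    exact ⟨⟨v, hVT ▸ hv⟩, rfl⟩
  have hΓ : Γ.Connected := by
    have := hT.nonempty.map f
    refine ⟨fun a b => ?_⟩
    obtain ⟨x, rfl⟩ := hsurj a
    obtain ⟨y, rfl⟩ := hsurj b
    rw [SimpleGraph.reachable_iff_reflTransGen]
    exact Relation.ReflTransGen.lift' (f := f) hstep _ _
      ((SimpleGraph.reachable_iff_reflTransGen _ _).1 (hT.preconnected x y))
  have hcard := hΓ.card_vert_le_card_edgeSet_add_one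
  rw [Nat.card_eq_fintype_card, Fintype.card_coe] at hcard
  refine hcard.trans (Nat.add_le_add_right (card_edgeSet_le Subtype.val_injective
    (p := fun e => r (p e)) (q := fun e => r (q e)) ?_) 1)
  intro a b hab
  rcases ((SimpleGraph.fromRel_adj _ _ _).1 hab).2 with h | ⟨e, he, hr⟩
  exacts [h, ⟨e, he, hr.trans Sym2.eq_swap⟩]

omit [DecidableEq α] in
lemma mul_card_image_le_of_isTreeConnected [DecidableEq ι] (hH : H.IsTreeConnected m)
    (hVH : V(H) = (Y : Set α)) (hends : IsEnds H p q) (r : α → ι)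
    (hD : ∀ e ∈ E(H), r (p e) ≠ r (q e) → e ∈ D) : m * #(Y.image r) ≤ #D + m := by
  classical
  obtain ⟨T, hT, hdisj⟩ := hH
  have htree : ∀ i ∈ univ, #(Y.image r) ≤ #(D.filter (· ∈ E(T i))) + 1 := fun i _ =>
    card_image_le_of_connected (hT i).2.2.connected ((hT i).1.vertexSet_eq.trans hVH)
      (hends.mono (hT i).1.le) r fun e he hne =>
        mem_filter.2 ⟨hD e ((hT i).1.le.edgeSet_mono he) hne, he⟩
  have hsum : ∑ i, #(D.filter (· ∈ E(T i))) ≤ #D := by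
    rw [← card_biUnion]
    · exact card_le_card (biUnion_subset.2 fun i _ => filter_subset _ _)
    · exact fun i _ j _ hij => disjoint_filter.2 fun e _ hi hj =>
        Set.disjoint_left.1 (hdisj hij) hi hj
  calc m * #(Y.image r) = ∑ _i : Fin m, #(Y.image r) := by simp
    _ ≤ ∑ i, (#(D.filter (· ∈ E(T i))) + 1) := sum_le_sum htree
    _ ≤ #D + m := by simpa [sum_add_distrib] using hsum

/-- If an `m`-tree-connected subgraph on `Y` meets several blocks, its trees use so many edges
between the blocks that the union of these blocks is tight. -/
lemma IsTightPartition.exists_superset_of_isTreeConnected {P : Finpartition V}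
    (hP : IsTightPartition p q m B P) (hm : 1 ≤ m) (hB : Sparse p q m B) (hF : IsEnds F p q)
    (hVF : V(F) = (V : Set α)) (hBF : ∀ e ∈ B, e ∈ E(F))
    (hspan : ∀ e ∈ E(F), e ∉ B → Spans p q m B e) (hYV : Y ⊆ V) (hYne : Y.Nonempty)
    (hY : (F.induce (Y : Set α)).IsTreeConnected m) : ∃ C ∈ P.parts, Y ⊆ C := by
  have hFV : ∀ e ∈ E(F), p e ∈ V ∧ q e ∈ V := fun e => hF.mem_vertexSet hVF
  have hle : F.induce (Y : Set α) ≤ F := Graph.induce_le (hVF ▸ mod_cast hYV)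
  set U := (Y.image P.part).biUnion id
  have hQ : Y.image P.part ⊆ P.parts := image_subset_iff.2 fun v hv => P.part_mem.2 (hYV hv)
  have hYU : Y ⊆ U := fun v hv =>
    mem_biUnion.2 ⟨P.part v, mem_image_of_mem _ hv, P.mem_part (hYV hv)⟩
  have hcross : ∀ e ∈ E(F.induce (Y : Set α)), P.part (p e) ≠ P.part (q e) →
      e ∈ inside p q (crossing p q P B) U := by
    intro e he hne
    have heF := hle.edgeSet_mono he
    have heY := (hF.mem_edgeSet_induce_iff heF).1 he
    have hblock : ∀ C ∈ P.parts, ¬ (p e ∈ C ∧ q e ∈ C) := fun C hC hCe =>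
      hne ((P.part_eq_of_mem hC hCe.1).trans (P.part_eq_of_mem hC hCe.2).symm)
    refine mem_inside.2 ⟨mem_crossing.2 ⟨?_, hblock⟩, hYU heY.1, hYU heY.2⟩
    by_contra heB
    obtain ⟨C, hC, hCe⟩ := hP.exists_block_of_spans hm hB (fun f hf => hFV f (hBF f hf))
      (hspan e heF heB) (hFV e heF).1
    exact hblock C hC hCe
  have htrees := mul_card_image_le_of_isTreeConnected hY rfl (hF.mono hle) P.part hcross
  have hUtight : Tight p q m B U := by
    have hedges := hP.card_inside hQ
    have := hB U (hYne.mono hYU)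
    exact ⟨hYne.mono hYU, by lia⟩
  obtain ⟨C, hC, hUC⟩ := hP.exists_superset U hUtight
    (biUnion_subset.2 fun C hC => P.subset (hQ hC))
  exact ⟨C, hC, hYU.trans hUC⟩

lemma isTreeComponent_of_maximal (hm : 1 ≤ m) (hB : Sparse p q m B)
    (hF : IsEnds F p q) (hVF : V(F) = (V : Set α)) (hBF : ∀ e ∈ B, e ∈ E(F))
    (hspan : ∀ e ∈ E(F), e ∉ B → Spans p q m B e)
    (hX : Maximal (fun T => Tight p q m B T ∧ T ⊆ V) X) : F.IsTreeComponent m (X : Set α) := by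
  obtain ⟨P, hP⟩ := exists_isTightPartition hB V
  have hXV : (X : Set α) ⊆ V(F) := hVF ▸ mod_cast hX.prop.2
  refine ⟨⟨hXV, hX.prop.1.isTreeConnected hB hF hBF hXV⟩, ?_⟩
  rintro Y' ⟨hYV, hY⟩ hXY
  rw [hVF] at hYV
  lift Y' to Finset α using V.finite_toSet.subset hYV with Y
  have hYne : Y.Nonempty := hX.prop.1.1.mono (mod_cast hXY)
  obtain ⟨C, hC, hYC⟩ := hP.exists_superset_of_isTreeConnected hm hB hF hVF hBF hspan
    (mod_cast hYV) hYne hY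
  exact_mod_cast hYC.trans (hX.2 (hP.maximal hC).prop ((mod_cast hXY : X ⊆ Y).trans hYC))

lemma boundaryDegree_eq (hF : IsEnds F p q) (hE : ∀ e, e ∈ E ↔ e ∈ E(F)) (X : Finset α) :
    F.boundaryDegree (X : Set α) = boundary p q E X := by
  rw [Graph.boundaryDegree, boundary, ← Set.ncard_coe_finset]
  congr 1
  ext e
  simp only [Set.mem_ofPred_eq, mem_coe, coe_filter]
  constructor
  · rintro ⟨x, hx, y, hy, h⟩
    refine ⟨(hE e).2 h.edge_mem, ?_⟩
    rcases (hF.isLink_iff h.edge_mem).1 h with ⟨rfl, rfl⟩ | ⟨rfl, rfl⟩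
    exacts [.inl ⟨hx, hy⟩, .inr ⟨hy, hx⟩]
  · rintro ⟨he, ⟨hp, hq⟩ | ⟨hp, hq⟩⟩
    exacts [⟨p e, hp, q e, hq, hF e ((hE e).1 he)⟩, ⟨q e, hq, p e, hp, (hF e ((hE e).1 he)).symm⟩]

omit [DecidableEq α] in
lemma card_image_le_numComponents [DecidableEq ι] (hG : IsEnds G p q)
    (hVG : V(G) = (K : Set α)) (r : α → ι) (hr : ∀ e ∈ E(G), r (p e) = r (q e)) :
    #(K.image r) ≤ G.numComponents := by
  have : Finite V(G) := hVG ▸ K.finite_toSet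
  have hadj : ∀ x y : V(G), G.toSimpleGraph.Adj x y → r x = r y := by
    rintro x y ⟨-, e, he⟩
    have hre := hr e he.edge_mem
    rcases (hG.isLink_iff he.edge_mem).1 he with ⟨hp, hq⟩ | ⟨hp, hq⟩ <;> rw [hp, hq] at hre
    exacts [hre, hre.symm]
  have hreach : ∀ x y : V(G), G.toSimpleGraph.Reachable x y → r x = r y := by
    rintro x y ⟨walk⟩
    induction walk with
    | nil => rfl
    | cons h _ ih => exact (hadj _ _ h).trans ih
  let label : G.toSimpleGraph.ConnectedComponent → ι := Quot.lift (fun x : V(G) => r x) hreach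
  have hsub : ((K.image r : Finset ι) : Set ι) ⊆ Set.range label := by
    rw [coe_image]
    rintro _ ⟨v, hv, rfl⟩
    exact ⟨Quot.mk _ ⟨v, hVG ▸ hv⟩, rfl⟩
  have : Finite G.toSimpleGraph.ConnectedComponent := Quot.finite _
  rw [Graph.numComponents, ← Set.ncard_coe_finset]
  exact (Set.ncard_le_ncard hsub (Set.finite_range label)).trans (Finite.card_range_le label)

end Trees

section Graphs

variable {α β : Type*} {p q : β → α} {m : ℕ} {F G : Graph α β} {E M : Finset β}
  {V : Finset α} {u v : α}

lemma exists_sparse_spans [DecidableEq α] (p q : β → α) (k : ℕ) (E : Finset β) :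
    ∃ B ⊆ E, Sparse p q k B ∧ ∀ e ∈ E, e ∉ B → Spans p q k B e := by
  classical
  obtain ⟨B, -, hB⟩ := {B ∈ E.powerset | Sparse p q k B}.exists_le_maximal (a := ∅)
    (mem_filter.2 ⟨empty_mem_powerset E, sparse_empty⟩)
  obtain ⟨hBE, hBsparse⟩ := mem_filter.1 hB.prop
  rw [mem_powerset] at hBE
  refine ⟨B, hBE, hBsparse, fun e he heB => spans_of_not_sparse_insert hBsparse fun hins => heB ?_⟩
  exact hB.2 (mem_filter.2 ⟨mem_powerset.2 (insert_subset he hBE), hins⟩) (subset_insert e B)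
    (mem_insert_self e B)

lemma incidenceSet_restrict_union (hG : IsEnds G p q) (hFG : F ≤ G) (hM : ∀ e ∈ M, e ∈ E(G)) :
    (G.restrict (E(F) ∪ M)).incidenceSet v = F.incidenceSet v ∪ {e | e ∈ M ∧ Inc p q e v} := by
  ext e
  simp only [Graph.mem_incidenceSet, Graph.restrict_inc, Set.mem_union, Set.mem_ofPred_eq, mem_coe]
  constructor
  · rintro ⟨h, he | he⟩
    exacts [.inl ((hFG.inc_congr he).2 h), .inr ⟨he, (hG.inc_iff (hM e he)).1 h⟩]
  · rintro (h | ⟨he, h⟩)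
    exacts [⟨h.mono hFG, .inl h.edge_mem⟩, ⟨(hG.inc_iff (hM e he)).2 h, .inr he⟩]

lemma degree_restrict_union_le (hG : IsEnds G p q) (hFG : F ≤ G) (hM : ∀ e ∈ M, e ∈ E(G))
    (hmatching : ∀ e ∈ M, ∀ f ∈ M, Inc p q e v → Inc p q f v → e = f) :
    (G.restrict (E(F) ∪ M)).degree v ≤ F.degree v + 1 := by
  rw [Graph.degree, Graph.degree, incidenceSet_restrict_union hG hFG hM]
  refine (Set.ncard_union_le _ _).trans (Nat.add_le_add_left ?_ _)
  exact (Set.ncard_le_one (M.finite_toSet.subset fun e he => he.1)).2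
    fun e he f hf => hmatching e he.1 f hf.1 he.2 hf.2

lemma degree_restrict_union_of_misses (hG : IsEnds G p q) (hFG : F ≤ G)
    (hM : ∀ e ∈ M, e ∈ E(G)) (hu : Misses p q M u) :
    (G.restrict (E(F) ∪ M)).degree u = F.degree u := by
  have hempty : {e | e ∈ M ∧ Inc p q e u} = ∅ :=
    Set.eq_empty_of_forall_notMem fun e he => hu e he.1 he.2
  rw [Graph.degree, Graph.degree, incidenceSet_restrict_union hG hFG hM, hempty, Set.union_empty]

variable [DecidableEq α]

lemma card_image_le_numComponents_deleteVerts {ι : Type*} [DecidableEq ι] {K : Finset α}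
    (hG : IsEnds G p q) (hVG : V(G) = (V : Set α)) (hKV : K ⊆ V) (r : α → ι)
    (hr : ∀ e ∈ E(G), p e ∈ K → q e ∈ K → r (p e) = r (q e)) :
    #(K.image r) ≤ (G.deleteVerts ((V \ K : Finset α) : Set α)).numComponents := by
  have hK : V(G.deleteVerts ((V \ K : Finset α) : Set α)) = (K : Set α) := by
    rw [Graph.vertexSet_deleteVerts, hVG, ← coe_sdiff, Finset.sdiff_sdiff_eq_self hKV]
  have hends := hG.mono (Graph.deleteVerts_le (X := ((V \ K : Finset α) : Set α)))
  refine card_image_le_numComponents hends hK r fun e he => ?_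
  obtain ⟨hp, hq⟩ := hends.mem_vertexSet hK he
  exact hr e (Graph.deleteVerts_le.edgeSet_mono he) hp hq

open Classical in
theorem exists_feasible_tight [DecidableEq β] {c : ℝ} (hm : 1 ≤ m) (hc : 2 ≤ c) (hG : IsEnds G p q)
    (hVG : V(G) = (V : Set α)) (hEG : E(G) = (E : Set β)) (hF : F ≤s G)
    (hcomp : ∀ X : Set α, F.IsTreeComponent m X →
      c - (c - 1) / (2 * (m : ℝ)) * (F.boundaryDegree X : ℝ) ≤ (X.ncard : ℝ))
    (htough : ∀ S : Set α, S ⊆ V(G) → ((G.deleteVerts S).numComponents : ℝ) ≤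
      (c - 2 * (m : ℝ)) / (2 * (m : ℝ) * (c - 1)) * (S.ncard : ℝ) + 1)
    (hu : u ∈ V) :
    ∃ B M, (∀ e ∈ B, e ∈ E(F)) ∧ Feasible p q m B {e ∈ E | e ∉ E(F)} u M ∧
      Tight p q m (B ∪ M) V := by
  have hmemE : ∀ {e}, e ∈ E ↔ e ∈ E(G) := by simp [hEG]
  have hmemF : ∀ e, e ∈ E.filter (· ∈ E(F)) ↔ e ∈ E(F) := fun e => by
    rw [mem_filter, hmemE, and_iff_right_of_imp fun he => hF.le.edgeSet_mono he]
  have hEV : ∀ e ∈ E, p e ∈ V ∧ q e ∈ V := fun e he => hG.mem_vertexSet hVG (hmemE.1 he)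
  obtain ⟨B, hBF, hB, hspan⟩ := exists_sparse_spans p q m (E.filter (· ∈ E(F)))
  have hsize : ∀ C, Maximal (fun T => Tight p q m B T ∧ T ⊆ V) C →
      c - (c - 1) / (2 * (m : ℝ)) * boundary p q (E.filter (· ∈ E(F))) C ≤ #C := fun C hC => by
    have := hcomp C (isTreeComponent_of_maximal hm hB (hG.mono hF.le) (hF.vertexSet_eq.trans hVG)
      (fun e he => (hmemF e).1 (hBF he)) (fun e he => hspan e ((hmemF e).2 he)) hC)
    rwa [boundaryDegree_eq (hG.mono hF.le) hmemF, Set.ncard_coe_finset] at this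
  obtain ⟨M, hM, hcard⟩ := exists_feasible_card_eq (N := E.filter (· ∉ E(F))) hm hc
    (fun e he => hEV e (filter_subset _ _ he)) (fun e he => hEV e (filter_subset _ _ he))
    (disjoint_filter_filter_not _ _ _) hB hBF hspan hsize (u := u)
    (fun K hKV r hr => by
      have hS := htough (V \ K : Finset α) (hVG ▸ mod_cast sdiff_subset)
      rw [Set.ncard_coe_finset] at hS
      refine (Nat.cast_le.2 (card_image_le_numComponents_deleteVerts hG hVG hKV r
        fun e he => hr e ?_)).trans hS
      rwa [filter_union_filter_not_eq, hmemE]) hu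
  refine ⟨B, M, fun e he => (hmemF e).1 (hBF he), hM, ⟨u, hu⟩, ?_⟩
  rw [inside_eq_self fun e he => hEV e ?_, hcard]
  exact (mem_union.1 he).elim (fun h => filter_subset _ _ (hBF h))
    fun h => filter_subset _ _ (hM.subset h)

end Graphs

end EdgeSparse

open EdgeSparse in
/-- Loops of `H` are loops of `F`, so the bounds on the degrees of `H` hold whether a loop is
counted once or twice. -/
theorem mainTheorem11_general {α β : Type*} (G F : Graph α β)
    (hVfin : V(G).Finite) (hEfin : E(G).Finite)
    (m : ℕ) (hm : 1 ≤ m) (c : ℝ) (hc : 2 ≤ c)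
    (hF : F ≤s G)
    (hcomp : ∀ X : Set α, F.IsTreeComponent m X →
      c - (c - 1) / (2 * (m : ℝ)) * (F.boundaryDegree X : ℝ) ≤ (X.ncard : ℝ))
    (htough : ∀ S : Set α, S ⊆ V(G) →
      ((G.deleteVerts S).numComponents : ℝ) ≤
        (c - 2 * (m : ℝ)) / (2 * (m : ℝ) * (c - 1)) * (S.ncard : ℝ) + 1)
    (u : α) (hu : u ∈ V(G)) :
    ∃ H : Graph α β, F ≤s H ∧ H ≤s G ∧ H.IsTreeConnected m ∧
      (∀ v ∈ V(G), H.degree v ≤ F.degree v + 1) ∧ H.degree u = F.degree u := by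
  classical
  have : Nonempty α := ⟨u⟩
  obtain ⟨p, q, hG⟩ := exists_isEnds G
  obtain ⟨B, M, hBF, hM, htight⟩ := exists_feasible_tight hm hc hG (hVfin.coe_toFinset).symm
    (hEfin.coe_toFinset).symm hF hcomp htough (hVfin.mem_toFinset.2 hu)
  have hMG : ∀ e ∈ M, e ∈ E(G) := fun e he =>
    hEfin.mem_toFinset.1 (Finset.mem_filter.1 (hM.subset he)).1
  set H := G.restrict (E(F) ∪ M)
  have hHG : H ≤s G := ⟨Graph.restrict_le, rfl⟩
  have hFH : F ≤s H := ⟨⟨hF.vertexSet_eq.subset, fun e x y h =>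
    ⟨.inl h.edge_mem, h.mono hF.le⟩⟩, hF.vertexSet_eq⟩
  have hBMH : ∀ e ∈ B ∪ M, e ∈ E(H) := fun e he => (Finset.mem_union.1 he).elim
    (fun h => hFH.le.edgeSet_mono (hBF e h)) fun h => ⟨hMG e h, .inr h⟩
  have hconn := htight.isTreeConnected hM.sparse (hG.mono hHG.le) hBMH
    (hVfin.coe_toFinset.subset)
  rw [hVfin.coe_toFinset, ← hHG.vertexSet_eq, Graph.induce_vertexSet] at hconn
  exact ⟨H, hFH, hHG, hconn,
    fun v _ => degree_restrict_union_le hG hF.le hMG fun e he f hf => hM.eq_of_inc e he f hf v,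
    degree_restrict_union_of_misses hG hF.le hMG hM.misses⟩

theorem mainTheorem11 {α β : Type*} (G F : Graph α β) [G.Loopless]
    (hVfin : V(G).Finite) (hEfin : E(G).Finite)
    (m : ℕ) (hm : 1 ≤ m) (c : ℝ) (hc : 2 * (m : ℝ) + 1 ≤ c)
    (hF : F ≤s G)
    (hcomp : ∀ X : Set α, F.IsTreeComponent m X →
      c - (c - 1) / (2 * (m : ℝ)) * (F.boundaryDegree X : ℝ) ≤ (X.ncard : ℝ))
    (htough : ∀ S : Set α, S ⊆ V(G) →
      ((G.deleteVerts S).numComponents : ℝ) ≤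
        (c - 2 * (m : ℝ)) / (2 * (m : ℝ) * (c - 1)) * (S.ncard : ℝ) + 1)
    (u : α) (hu : u ∈ V(G)) :
    ∃ H : Graph α β, F ≤s H ∧ H ≤s G ∧ H.IsTreeConnected m ∧
      (∀ v ∈ V(G), H.degree v ≤ F.degree v + 1) ∧ H.degree u = F.degree u := by
  have hm' : (1 : ℝ) ≤ m := mod_cast hm
  exact mainTheorem11_general G F hVfin hEfin m hm c (by linarith) hF hcomp htough u hu
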